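/- Let $n\in\mathbb N$, $\hbar\in(0,1]$, $\hbar\mathbb Z^n=\{\hbar m: m\in\mathbb Z^n\}\subset\mathbb R^n$ with the Euclidean norm $|k|$, $\mathbb T^n=\mathbb R^n/\mathbb Z^n$ with normalised Haar measure, and $k\cdot\theta=\hbar\sum_j m_j\theta_j$ for $k=\hbar m$. For multi-indices $\alpha,\beta\in\mathbb N_0^n$ put $$\Delta_{\hbar,j}g(k)=\frac{g(k+\hbar v_j)-g(k)}{\hbar},\quad \Delta_\hbar^\alpha=\Delta_{\hbar,1}^{\alpha_1}\cdots\Delta_{\hbar,n}^{\alpha_n},\qquad D^{(\beta)}_{\hbar,\theta}=\hbar^{|\beta|}\prod_{j=1}^n\prod_{\ell=0}^{\beta_j-1}\Big(\frac1{2\pi i}\frac{\partial}{\partial\theta_j}-\ell\Big),$$ where $v_j$ is the $j$-th unit vector. For $\mu,\rho,\delta\in\mathbb R$ the symbol class $S^\mu_{\rho,\delta}(\hbar\mathbb Z^n\times\mathbb T^n)$ consists of the functions $\sigma:\hbar\mathbb Z^n\times\mathbb T^n\to\mathbb C$ with $\sigma(k,\cdot)\in C^\infty(\mathbb T^n)$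 for all $k$ and such that for all $\alpha,\beta$ there is $C>0$ with $$|D^{(\beta)}_{\hbar,\theta}\Delta^\alpha_{\hbar,k}\sigma(k,\theta)|\le C(1+|k|)^{\mu-\rho|\alpha|+\delta|\beta|}\quad\text{for all }k,\theta.$$ The amplitude class $\mathcal A^{\mu_1,\mu_2}_{\rho,\delta}(\hbar\mathbb Z^n\times\hbar\mathbb Z^n\times\mathbb T^n)$ consists of the functions $a:\hbar\mathbb Z^n\times\hbar\mathbb Z^n\times\mathbb T^n\to\mathbb C$ with $a(k,m,\cdot)\in C^\infty(\mathbb T^n)$ for all $k,m$ and such that for all $\alpha,\beta,\gamma$ there are $C>0$ and an integer $0\le Q\le|\gamma|$ with $$|D^{(\gamma)}_{\hbar,\theta}\Delta^\alpha_{\hbar,k}\Delta^\beta_{\hbar,m}a(k,m,\theta)|\le C(1+|k|)^{\mu_1-\rho|\alpha|+\delta Q}(1+|m|)^{\mu_2-\rho|\beta|+\delta(|\gamma|-Q)}\quad\text{for all }k,m,\theta.$$ Let $\mathcal S(\hbar\mathbb Z^n)$ be the space of functions $f:\hbar\mathbb Z^n\to\mathbb C$ such that for every $N\in\mathbb N$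 there is $C$ with $|f(k)|\le C(1+|k|)^{-N}$ for all $k$. For $f\in\mathcal S(\hbar\mathbb Z^n)$ and a symbol $\sigma$ let $$\widehat f(\theta)=\sum_{k\in\hbar\mathbb Z^n}e^{-2\pi\frac i\hbar k\cdot\theta}f(k),\qquad \mathrm{Op}(\sigma)f(k)=\int_{\mathbb T^n}e^{2\pi\frac i\hbar k\cdot\theta}\sigma(k,\theta)\widehat f(\theta)\,d\theta .$$ **Theorem.** Let $0\le\delta<\rho\le1$, $\mu_1,\mu_2\in\mathbb R$, and let $a\in\mathcal A^{\mu_1,\mu_2}_{\rho,\delta}(\hbar\mathbb Z^n\times\hbar\mathbb Z^n\times\mathbb T^n)$. For every $f\in\mathcal S(\hbar\mathbb Z^n)$ and $k\in\hbar\mathbb Z^n$ the series $$Tf(k)=\sum_{l\in\hbar\mathbb Z^n}\int_{\mathbb T^n}e^{2\pi\frac i\hbar(k-l)\cdot\theta}a(k,l,\theta)f(l)\,d\theta$$ converges absolutely, and there is $\sigma_T\in S^{\mu_1+\mu_2}_{\rho,\delta}(\hbar\mathbb Z^n\times\mathbb T^n)$ such that $T=\mathrm{Op}(\sigma_T)$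 on $\mathcal S(\hbar\mathbb Z^n)$ and $$\sigma_T(k,\theta)\sim\sum_\alpha\frac1{\alpha!}\Delta^\alpha_{\hbar,l}D^{(\alpha)}_{\hbar,\theta}a(k,l,\theta)\Big|_{l=k},$$ that is, for all $N\in\mathbb N$, $$\sigma_T(k,\theta)-\sum_{|\alpha|<N}\frac1{\alpha!}\Delta^\alpha_{\hbar,l}D^{(\alpha)}_{\hbar,\theta}a(k,l,\theta)\Big|_{l=k}\in S^{\mu_1+\mu_2-N(\rho-\delta)}_{\rho,\delta}(\hbar\mathbb Z^n\times\mathbb T^n).$$ -/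

import Mathlib

open MeasureTheory
open scoped ContDiff Nat

noncomputable section

namespace SemiclassicalLattice

/-- The lattice `h ℤⁿ = {h m : m ∈ ℤⁿ}`, `h > 0`, in its integer coordinates: `k : HLattice n`
stands for the point `h k = (h k₁, …, h kₙ)` of `ℝⁿ`, so that a function on `h ℤⁿ` is a function
on `HLattice n`. The parameter `h` enters through `latticeNorm` and `latticeDiff`. -/
abbrev HLattice (n : ℕ) : Type := Fin n → ℤ

/-- The torus `𝕋ⁿ = ℝⁿ / ℤⁿ`, with its normalised Haar measure `volume`. -/
abbrev Torus (n : ℕ) : Type := UnitAddTorus (Fin n)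

/-- The Euclidean norm of the lattice point with integer coordinates `k`, that is, of the vector
`h k ∈ ℝⁿ`. -/
def latticeNorm {n : ℕ} (h : ℝ) (k : HLattice n) : ℝ :=
  ‖h • (WithLp.toLp 2 (fun j => (k j : ℝ)) : EuclideanSpace ℝ (Fin n))‖

/-- The character `exp (2 π i / h * (h k) ⬝ θ) = exp (2 π i (k₁ θ₁ + ⋯ + kₙ θₙ))` of the torus
attached to the lattice point `h k`. -/
def latticeChar {n : ℕ} (k : HLattice n) (θ : Torus n) : ℂ :=
  UnitAddTorus.mFourier k θ

/-- The order `|α| = α₁ + ⋯ + αₙ` of a multi-index. -/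
def order {n : ℕ} (α : Fin n → ℕ) : ℕ := ∑ j, α j

/-- The factorial `α! = α₁! ⋯ αₙ!` of a multi-index. -/
def multiFactorial {n : ℕ} (α : Fin n → ℕ) : ℕ := ∏ j, (α j)!

/-- The finite set of the multi-indices `α` with `|α| < N` (see `mem_multiIndexLT`). -/
def multiIndexLT (n N : ℕ) : Finset (Fin n → ℕ) :=
  (Fintype.piFinset fun _ : Fin n => Finset.range N).filter fun α => order α < N

theorem mem_multiIndexLT {n N : ℕ} (α : Fin n → ℕ) : α ∈ multiIndexLT n N ↔ order α < N := by
  simp only [multiIndexLT, Finset.mem_filter, Fintype.mem_piFinset, Finset.mem_range,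
    and_iff_right_iff_imp]
  intro hα j
  exact lt_of_le_of_lt (Finset.single_le_sum (fun i _ => Nat.zero_le (α i)) (Finset.mem_univ j)) hα

/-- The difference operator `Δ_{h,j} g (x) = (g (x + h v_j) - g x) / h` at the lattice point
`x = h k`, where `v_j` is the `j`-th unit vector. -/
def latticeDiff {n : ℕ} (h : ℝ) (j : Fin n) (g : HLattice n → ℂ) : HLattice n → ℂ :=
  fun k => (g (k + Pi.single j 1) - g k) / (h : ℂ)

/-- The difference operator `Δ_h^α = Δ_{h,1}^{α₁} ⋯ Δ_{h,n}^{αₙ}`. -/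
def multiDiff {n : ℕ} (h : ℝ) (α : Fin n → ℕ) (g : HLattice n → ℂ) : HLattice n → ℂ :=
  (List.finRange n).foldr (fun j g' => (latticeDiff h j)^[α j] g') g

/-- `f ∈ C^∞(𝕋ⁿ)`: the periodic function on `ℝⁿ` induced by `f` is smooth. -/
def IsSmoothOnTorus {n : ℕ} (f : Torus n → ℂ) : Prop :=
  ContDiff ℝ ∞ fun x : Fin n → ℝ => f fun j => (x j : UnitAddCircle)

/-- The partial derivative `∂ f / ∂ θ_j` of a function on the torus. -/
def torusPartial {n : ℕ} (j : Fin n) (f : Torus n → ℂ) : Torus n → ℂ :=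
  fun θ => deriv (fun t : ℝ => f (θ + Pi.single j (t : UnitAddCircle))) 0

/-- The operator `D_{h,θ_j}^{(b)} = h ^ b * ∏_{ℓ = 0}^{b - 1} ((2 π i)⁻¹ ∂ / ∂ θ_j - ℓ)`,
built by adding the factor with `ℓ = b` in the step from `b` to `b + 1`. -/
def torusD {n : ℕ} (h : ℝ) (j : Fin n) : ℕ → (Torus n → ℂ) → (Torus n → ℂ)
  | 0, f => f
  | b + 1, f => fun θ =>
      (h : ℂ) * ((2 * (Real.pi : ℂ) * Complex.I)⁻¹ * torusPartial j (torusD h j b f) θ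
        - (b : ℂ) * torusD h j b f θ)

/-- The operator `D_{h,θ}^{(β)} = D_{h,θ_1}^{(β₁)} ⋯ D_{h,θ_n}^{(βₙ)}`. -/
def multiD {n : ℕ} (h : ℝ) (β : Fin n → ℕ) (f : Torus n → ℂ) : Torus n → ℂ :=
  (List.finRange n).foldr (fun j f' => torusD h j (β j) f') f

/-- The symbol class `S^μ_{ρ,δ}(hℤⁿ × 𝕋ⁿ)`. -/
def SymbolClass (n : ℕ) (h ρ δ μ : ℝ) : Set (HLattice n → Torus n → ℂ) :=
  {σ | (∀ k, IsSmoothOnTorus (σ k)) ∧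
    ∀ α β : Fin n → ℕ, ∃ C : ℝ, 0 < C ∧ ∀ (k : HLattice n) (θ : Torus n),
      ‖multiD h β (fun θ' => multiDiff h α (fun k' => σ k' θ') k) θ‖
        ≤ C * (1 + latticeNorm h k) ^ (μ - ρ * (order α : ℝ) + δ * (order β : ℝ))}

/-- The amplitude class `𝒜^{μ₁,μ₂}_{ρ,δ}(hℤⁿ × hℤⁿ × 𝕋ⁿ)`. -/
def AmplitudeClass (n : ℕ) (h ρ δ μ₁ μ₂ : ℝ) : Set (HLattice n → HLattice n → Torus n → ℂ) :=
  {a | (∀ k m, IsSmoothOnTorus (a k m)) ∧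
    ∀ α β γ : Fin n → ℕ, ∃ C : ℝ, 0 < C ∧ ∃ Q : ℕ, Q ≤ order γ ∧
      ∀ (k m : HLattice n) (θ : Torus n),
        ‖multiD h γ (fun θ' =>
            multiDiff h α (fun k' => multiDiff h β (fun m' => a k' m' θ') m) k) θ‖
          ≤ C * (1 + latticeNorm h k) ^ (μ₁ - ρ * (order α : ℝ) + δ * (Q : ℝ))
            * (1 + latticeNorm h m) ^
              (μ₂ - ρ * (order β : ℝ) + δ * ((order γ : ℝ) - (Q : ℝ)))}

/-- The Schwartz space `𝒮(hℤⁿ)` of rapidly decreasing functions. -/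
def SchwartzLattice (n : ℕ) (h : ℝ) : Set (HLattice n → ℂ) :=
  {f | ∀ N : ℕ, ∃ C : ℝ, ∀ k : HLattice n, ‖f k‖ ≤ C * (1 + latticeNorm h k) ^ (-(N : ℝ))}

/-- The Fourier transform `f̂ (θ) = ∑_{x ∈ hℤⁿ} exp (- 2 π i / h * x ⬝ θ) f x`. -/
def latticeFourier {n : ℕ} (f : HLattice n → ℂ) (θ : Torus n) : ℂ :=
  ∑' k : HLattice n, latticeChar (-k) θ * f k

/-- The pseudo-differential operator with symbol `σ`:
`Op σ f (x) = ∫ exp (2 π i / h * x ⬝ θ) σ (x, θ) f̂ (θ) dθ`. -/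
def symbolOp {n : ℕ} (σ : HLattice n → Torus n → ℂ) (f : HLattice n → ℂ) : HLattice n → ℂ :=
  fun k => ∫ θ : Torus n, latticeChar k θ * σ k θ * latticeFourier f θ

/-- The summand `∫ exp (2 π i / h * (x - y) ⬝ θ) a (x, y, θ) f y dθ` of an amplitude operator. -/
def amplitudeTerm {n : ℕ} (a : HLattice n → HLattice n → Torus n → ℂ) (f : HLattice n → ℂ)
    (k l : HLattice n) : ℂ :=
  ∫ θ : Torus n, latticeChar (k - l) θ * a k l θ * f l

/-- The amplitude operator
`T f (x) = ∑_{y ∈ hℤⁿ} ∫ exp (2 π i / h * (x - y) ⬝ θ) a (x, y, θ) f y dθ`. -/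
def amplitudeOp {n : ℕ} (a : HLattice n → HLattice n → Torus n → ℂ) (f : HLattice n → ℂ) :
    HLattice n → ℂ :=
  fun k => ∑' l : HLattice n, amplitudeTerm a f k l

/-- The term `(1 / α!) Δ_{h,l}^α D_{h,θ}^{(α)} a (k, l, θ)` at `l = k`. -/
def expansionTerm {n : ℕ} (h : ℝ) (a : HLattice n → HLattice n → Torus n → ℂ) (α : Fin n → ℕ)
    (k : HLattice n) (θ : Torus n) : ℂ :=
  (1 / (multiFactorial α : ℂ)) * multiDiff h α (fun l => multiD h α (a k l) θ) k

end SemiclassicalLattice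

end

open MeasureTheory
open scoped ContDiff Nat

noncomputable section

namespace SemiclassicalLattice

/-! Write `c(k,l,j)` for the `j`-th Fourier coefficient of `a(k,l,·)`. The operator `T` has matrix
entries `c(k,l,l-k)`, and `Op(σ)` has the coefficients of `σ(k,·)` at `l-k`. So the `j`-th
coefficient of `σ_T(k,·)` should be `c(k,k+j,j)`, which defines `amplitudeSymbol`.

On the `j`-th coefficient, `D^{(α)}` acts as a product of falling factorials of `j`, and these are
the Newton basis dual to the forward differences. The term of index `α` in the expansion therefore
has as `j`-th coefficient the term of index `α` in Newton's formula for `l ↦ c(k,l,j)` about `k`,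
evaluated at `k+j`. The asymptotic expansion is Newton's formula, one frequency at a time, and its
error is `newtonRemainder`.

The remainder of order `M` is controlled by `‖j‖^M` times the `M`-th differences within distance
`‖j‖` of `k`. If `‖j‖ ≤ ‖k‖/2`, the positions are comparable: the differences gain `ρM` powers of
`k`, the `M+p` derivatives that buy decay in `j` lose `δ(M+p)`, and `δ < ρ` wins. Otherwise the
frequency dominates the positions, and since `δ < 1` the decay in `j` beats every power of them.
This is `newtonRemainder_coeff_le`.

Hence every `D^{(β)}` of the error is `O(|k|^{-K})` once `M` is large. Its differences need no
separate estimate: they are finite combinations of translates, which respect such bounds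
(`mem_symbolClass_of_approx`). The terms with `N ≤ |α| < M` are symbols of the right order by a
discrete Leibniz rule on the diagonal (`expansionTerm_mem_symbolClass`). -/

variable {n : ℕ}

/-! ### Weights on the lattice -/

/-- The weight `1 + ‖k‖` for the supremum norm of the integer coordinates of a lattice point. -/
def weight (k : HLattice n) : ℝ := 1 + ‖k‖

theorem one_le_weight (k : HLattice n) : 1 ≤ weight k :=
  le_add_of_nonneg_right (norm_nonneg k)

theorem weight_pos (k : HLattice n) : 0 < weight k :=
  zero_lt_one.trans_le (one_le_weight k)

theorem weight_rpow_pos (k : HLattice n) (s : ℝ) : 0 < weight k ^ s :=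
  Real.rpow_pos_of_pos (weight_pos k) s

theorem weight_rpow_le_rpow (k : HLattice n) {s t : ℝ} (hst : s ≤ t) :
    weight k ^ s ≤ weight k ^ t :=
  Real.rpow_le_rpow_of_exponent_le (one_le_weight k) hst

theorem weight_add_le (k v : HLattice n) : weight (k + v) ≤ weight k * weight v := by
  unfold weight
  nlinarith [norm_add_le k v, mul_nonneg (norm_nonneg k) (norm_nonneg v)]

theorem weight_neg (k : HLattice n) : weight (-k) = weight k := by
  simp [weight]

/-- A comparison of real powers of two positive numbers with bounded ratio. -/
theorem rpow_le_rpow_abs_mul {x y R : ℝ} (hx : 0 < x) (hy : 0 < y) (hR : 1 ≤ R)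
    (hxy : x ≤ R * y) (hyx : y ≤ R * x) (s : ℝ) : x ^ s ≤ R ^ |s| * y ^ s := by
  have hR0 : 0 < R := zero_lt_one.trans_le hR
  rcases le_total 0 s with hs | hs
  · rw [abs_of_nonneg hs, ← Real.mul_rpow hR0.le hy.le]
    exact Real.rpow_le_rpow hx.le hxy hs
  · rw [abs_of_nonpos hs, Real.rpow_neg hR0.le, ← Real.inv_rpow hR0.le,
      ← Real.mul_rpow (inv_nonneg.2 hR0.le) hy.le]
    refine Real.rpow_le_rpow_of_nonpos (by positivity) ?_ hs
    rwa [inv_mul_le_iff₀ hR0]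

/-- Peetre's inequality. -/
theorem weight_add_rpow_le (k v : HLattice n) (s : ℝ) :
    weight (k + v) ^ s ≤ weight v ^ |s| * weight k ^ s := by
  refine rpow_le_rpow_abs_mul (weight_pos _) (weight_pos _) (one_le_weight v) ?_ ?_ s
  · rw [mul_comm]; exact weight_add_le k v
  · have := weight_add_le (k + v) (-v)
    rw [weight_neg, add_neg_cancel_right] at this
    rwa [mul_comm]

theorem latticeNorm_nonneg (h : ℝ) (k : HLattice n) : 0 ≤ latticeNorm h k := norm_nonneg _

theorem exists_weight_comparison {h : ℝ} (hpos : 0 < h) :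
    ∃ R : ℝ, 1 ≤ R ∧ ∀ k : HLattice n,
      weight k ≤ R * (1 + latticeNorm h k) ∧ 1 + latticeNorm h k ≤ R * weight k := by
  -- The summand `h⁻¹` serves the first inequality, `h * n` the second.
  refine ⟨1 + h⁻¹ + h * n, by have := inv_pos.2 hpos; nlinarith [mul_nonneg hpos.le n.cast_nonneg],
    fun k => ?_⟩
  have hn : latticeNorm h k
      = h * ‖(WithLp.toLp 2 (fun j => (k j : ℝ)) : EuclideanSpace ℝ (Fin n))‖ := by
    rw [latticeNorm, norm_smul, Real.norm_of_nonneg hpos.le]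
  have h1 : ‖k‖ ≤ ‖(WithLp.toLp 2 (fun j => (k j : ℝ)) : EuclideanSpace ℝ (Fin n))‖ := by
    refine (pi_norm_le_iff_of_nonneg (norm_nonneg _)).2 fun i => ?_
    have := PiLp.norm_apply_le (WithLp.toLp 2 (fun j => (k j : ℝ)) : EuclideanSpace ℝ (Fin n)) i
    simpa [Int.norm_eq_abs] using this
  have h2 : ‖(WithLp.toLp 2 (fun j => (k j : ℝ)) : EuclideanSpace ℝ (Fin n))‖ ≤ n * ‖k‖ := by
    have e : (WithLp.toLp 2 (fun j => (k j : ℝ)) : EuclideanSpace ℝ (Fin n))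
        = ∑ i, EuclideanSpace.single i (k i : ℝ) := by
      ext j
      simp [Finset.sum_apply, Pi.single_apply]
    rw [e]
    refine (norm_sum_le _ _).trans ?_
    refine (Finset.sum_le_card_nsmul _ _ ‖k‖ fun i _ => ?_).trans (by simp)
    rw [PiLp.norm_single]
    simpa [Int.norm_eq_abs] using norm_le_pi_norm k i
  set E := ‖(WithLp.toLp 2 (fun j => (k j : ℝ)) : EuclideanSpace ℝ (Fin n))‖
  have hk := norm_nonneg k
  have hE : 0 ≤ E := norm_nonneg _
  have hi := inv_pos.2 hpos
  have hn0 : (0 : ℝ) ≤ n := n.cast_nonneg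
  have hhi : h⁻¹ * h = 1 := inv_mul_cancel₀ hpos.ne'
  rw [hn]
  unfold weight
  constructor
  · have : h⁻¹ * (h * E) = E := by rw [← mul_assoc, hhi, one_mul]
    nlinarith [mul_nonneg hpos.le hn0, mul_nonneg hpos.le hE,
      mul_nonneg (mul_nonneg hpos.le hn0) (mul_nonneg hpos.le hE)]
  · nlinarith [mul_nonneg hpos.le hn0, mul_nonneg hi.le hk, mul_le_mul_of_nonneg_left h2 hpos.le]

theorem exists_weight_rpow_le {h : ℝ} (hpos : 0 < h) (s : ℝ) :
    ∃ C : ℝ, 0 < C ∧ ∀ k : HLattice n, weight k ^ s ≤ C * (1 + latticeNorm h k) ^ s := by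
  obtain ⟨R, hR, hc⟩ := exists_weight_comparison (n := n) hpos
  exact ⟨R ^ |s|, by positivity, fun k => rpow_le_rpow_abs_mul (weight_pos k)
    (by have := latticeNorm_nonneg h k; linarith) hR (hc k).1 (hc k).2 s⟩

theorem exists_latticeNorm_rpow_le {h : ℝ} (hpos : 0 < h) (s : ℝ) :
    ∃ C : ℝ, 0 < C ∧ ∀ k : HLattice n, (1 + latticeNorm h k) ^ s ≤ C * weight k ^ s := by
  obtain ⟨R, hR, hc⟩ := exists_weight_comparison (n := n) hpos
  exact ⟨R ^ |s|, by positivity, fun k => rpow_le_rpow_abs_mul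
    (by have := latticeNorm_nonneg h k; linarith) (weight_pos k) hR (hc k).2 (hc k).1 s⟩

theorem summable_inv_one_add_abs_sq : Summable fun x : ℤ => ((1 + |(x : ℝ)|) ^ 2)⁻¹ := by
  have h : Summable fun m : ℕ => ((1 + (m : ℝ)) ^ 2)⁻¹ := by
    have := (summable_nat_add_iff 1).2 (Real.summable_nat_pow_inv.2 one_lt_two)
    simpa [add_comm] using this
  exact Summable.of_nat_of_neg (by simpa using h) (by simpa using h)

theorem summable_prod_apply {f : ℤ → ℝ} (hf0 : ∀ x, 0 ≤ f x) (hf : Summable f) :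
    ∀ n : ℕ, Summable fun j : Fin n → ℤ => ∏ i, f (j i)
  | 0 => Summable.of_finite
  | n + 1 => by
    have := hf.mul_of_nonneg (summable_prod_apply hf0 hf n) hf0
      fun j => Finset.prod_nonneg fun i _ => hf0 _
    rw [← (Fin.consEquiv fun _ : Fin (n + 1) => ℤ).summable_iff]
    refine this.congr fun x => ?_
    simp [Fin.consEquiv, Fin.prod_univ_succ]

/-- The weight dominates each `1 + |jᵢ|`, so its power `2n` dominates the product of their squares.
-/
theorem summable_weight : Summable fun j : HLattice n => weight j ^ (-(2 * n : ℝ)) := by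
  refine Summable.of_nonneg_of_le (fun j => (weight_rpow_pos j _).le) (fun j => ?_)
    (summable_prod_apply (fun x => by positivity) summable_inv_one_add_abs_sq n)
  rw [Real.rpow_neg (weight_pos j).le, Finset.prod_inv_distrib]
  refine inv_anti₀ (Finset.prod_pos fun i _ => by positivity) ?_
  have : weight j ^ (2 * n : ℝ) = ∏ _i : Fin n, weight j ^ 2 := by
    rw [Finset.prod_const, Finset.card_univ, Fintype.card_fin, ← pow_mul]
    exact_mod_cast Real.rpow_natCast (weight j) (2 * n)
  rw [this]
  refine Finset.prod_le_prod (fun i _ => by positivity) fun i _ => ?_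
  have hi := norm_le_pi_norm j i
  rw [Int.norm_eq_abs] at hi
  unfold weight
  gcongr

/-! ### The Haar measure of the torus -/

theorem volume_unitAddCircle : (volume : Measure UnitAddCircle) = AddCircle.haarAddCircle := by
  simpa using AddCircle.volume_eq_smul_haarAddCircle (T := (1 : ℝ))

instance isProbabilityMeasure_unitAddCircle :
    IsProbabilityMeasure (volume : Measure UnitAddCircle) := by
  rw [volume_unitAddCircle]
  infer_instance

theorem mFourierCoeff_eq_integral_latticeChar (f : Torus n → ℂ) (j : HLattice n) :
    UnitAddTorus.mFourierCoeff f j = ∫ θ : Torus n, latticeChar (-j) θ * f θ := by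
  unfold UnitAddTorus.mFourierCoeff latticeChar
  simp only [smul_eq_mul]
  congr 1
  change Measure.pi (fun _ => AddCircle.haarAddCircle)
    = Measure.pi (fun _ => (volume : Measure UnitAddCircle))
  rw [volume_unitAddCircle]

/-! ### Difference operators through the group algebra -/

/-- The translation `g ↦ g (· + v)` as a monoid homomorphism into the linear endomorphisms. -/
def shiftHom (n : ℕ) : Multiplicative (HLattice n) →* Module.End ℂ (HLattice n → ℂ) where
  toFun v := LinearMap.funLeft ℂ ℂ fun k => k + v.toAdd
  map_one' := by ext; simp
  map_mul' v w := by ext; simp [LinearMap.funLeft_apply, add_assoc]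

/-- The action of the group algebra of the lattice on functions by translations. -/
def shiftAction (n : ℕ) :
    AddMonoidAlgebra ℂ (HLattice n) →ₐ[ℂ] Module.End ℂ (HLattice n → ℂ) :=
  AddMonoidAlgebra.lift ℂ _ _ (shiftHom n)

/-- The element of the group algebra of the lattice that acts as `latticeDiff h j`. -/
def diffElement (h : ℝ) (j : Fin n) : AddMonoidAlgebra ℂ (HLattice n) :=
  (h : ℂ)⁻¹ • (AddMonoidAlgebra.single (Pi.single j 1) 1 - 1)

theorem shiftAction_diffElement (h : ℝ) (j : Fin n) (g : HLattice n → ℂ) :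
    shiftAction n (diffElement h j) g = latticeDiff h j g := by
  ext k
  simp [shiftAction, diffElement, latticeDiff, AddMonoidAlgebra.lift_single, shiftHom,
    LinearMap.funLeft_apply, div_eq_inv_mul, mul_sub]

/-- The group algebra is commutative, so the ordered composition becomes an unordered product and
composing differences adds exponents. -/
theorem multiDiff_eq_shiftAction (h : ℝ) (α : Fin n → ℕ) (g : HLattice n → ℂ) :
    multiDiff h α g = shiftAction n (∏ j, diffElement h j ^ α j) g := by
  have hfold : ∀ l : List (Fin n), l.foldr (fun j g' => (latticeDiff h j)^[α j] g') g
      = shiftAction n ((l.map fun j => diffElement h j ^ α j).prod) g := by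
    intro l
    induction l with
    | nil => simp
    | cons j l ih =>
      rw [List.foldr_cons, ih, List.map_cons, List.prod_cons, map_mul, map_pow,
        Module.End.mul_apply, Module.End.pow_apply]
      congr 1
      funext g'
      exact (shiftAction_diffElement h j g').symm
  rw [multiDiff, hfold, Fin.prod_univ_def]

theorem multiDiff_zero (h : ℝ) (g : HLattice n → ℂ) : multiDiff h 0 g = g := by
  simp [multiDiff_eq_shiftAction]

theorem multiDiff_add (h : ℝ) (α β : Fin n → ℕ) (g : HLattice n → ℂ) :
    multiDiff h (α + β) g = multiDiff h α (multiDiff h β g) := by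
  simp only [multiDiff_eq_shiftAction, ← Module.End.mul_apply, ← map_mul, ← Finset.prod_mul_distrib,
    Pi.add_apply, pow_add]

theorem multiDiff_single (h : ℝ) (i : Fin n) (g : HLattice n → ℂ) :
    multiDiff h (Pi.single i 1) g = latticeDiff h i g := by
  rw [multiDiff_eq_shiftAction, Finset.prod_eq_single i, Pi.single_eq_same, pow_one,
    shiftAction_diffElement]
  · intro j _ hj
    rw [Pi.single_eq_of_ne hj, pow_zero]
  · simp

/-- The operator `Δ_h^α` is a finite linear combination of translations. -/
theorem exists_multiDiff_eq_sum (h : ℝ) (α : Fin n → ℕ) :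
    ∃ (s : Finset (HLattice n)) (c : HLattice n → ℂ), ∀ (g : HLattice n → ℂ) (k : HLattice n),
      multiDiff h α g k = ∑ v ∈ s, c v * g (k + v) := by
  refine ⟨(∏ j, diffElement h j ^ α j).coeff.support, (∏ j, diffElement h j ^ α j).coeff, fun g k => ?_⟩
  rw [multiDiff_eq_shiftAction, shiftAction, AddMonoidAlgebra.lift_apply, Finsupp.sum]
  simp [LinearMap.sum_apply, Finset.sum_apply, shiftHom, LinearMap.funLeft_apply]

/-! ### Multi-indices and falling factorials -/

theorem order_zero : order (0 : Fin n → ℕ) = 0 := by simp [order]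

theorem order_add (α β : Fin n → ℕ) : order (α + β) = order α + order β := by
  simp [order, Finset.sum_add_distrib]

theorem order_single (i : Fin n) (b : ℕ) : order (Pi.single i b : Fin n → ℕ) = b := by
  simp [order]

theorem exists_eq_add_single {α : Fin n → ℕ} {i : Fin n} (hi : α i ≠ 0) :
    ∃ β : Fin n → ℕ, α = β + Pi.single i 1 := by
  refine ⟨α - Pi.single i 1, ?_⟩
  ext j
  rcases eq_or_ne j i with rfl | hj
  · simp; omega
  · simp [hj]

theorem multiIndex_induction {P : (Fin n → ℕ) → Prop} (zero : P 0)
    (add_single : ∀ α i, P α → P (α + Pi.single i 1)) (α : Fin n → ℕ) : P α := by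
  induction hN : order α generalizing α with
  | zero =>
    have : α = 0 := by
      ext j
      simpa [order] using (Finset.sum_eq_zero_iff.1 hN) j (Finset.mem_univ j)
    exact this ▸ zero
  | succ N ih =>
    obtain ⟨i, hi⟩ : ∃ i, α i ≠ 0 := by
      by_contra! hall
      simp [order, hall] at hN
    obtain ⟨β, rfl⟩ := exists_eq_add_single hi
    rw [order_add, order_single] at hN
    exact add_single β i (ih β (by omega))

/-- The Fourier multiplier `∏ i, ∏ ℓ < αᵢ, h (jᵢ - ℓ)` of the operator `D_h^{(α)}`. -/
def multiplier (h : ℝ) (α : Fin n → ℕ) (j : HLattice n) : ℝ :=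
  ∏ i, ∏ ℓ ∈ Finset.range (α i), h * ((j i : ℝ) - ℓ)

theorem multiplier_zero (h : ℝ) (j : HLattice n) : multiplier h 0 j = 1 := by simp [multiplier]

theorem multiplier_eq_mul_prod_erase (h : ℝ) (α : Fin n → ℕ) (i : Fin n) (j : HLattice n) :
    multiplier h α j = (∏ ℓ ∈ Finset.range (α i), h * ((j i : ℝ) - ℓ))
      * ∏ i' ∈ Finset.univ.erase i, ∏ ℓ ∈ Finset.range (α i'), h * ((j i' : ℝ) - ℓ) :=
  (Finset.mul_prod_erase _ _ (Finset.mem_univ i)).symm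

theorem multiplier_add_single (h : ℝ) (α : Fin n → ℕ) (i : Fin n) (j : HLattice n) :
    multiplier h (α + Pi.single i 1) j = h * ((j i : ℝ) - α i) * multiplier h α j := by
  rw [multiplier_eq_mul_prod_erase h _ i, multiplier_eq_mul_prod_erase h α i, ← mul_assoc]
  congr 1
  · simp [Finset.prod_range_succ, mul_comm]
  · refine Finset.prod_congr rfl fun i' hi' => ?_
    simp [Finset.ne_of_mem_erase hi']

theorem multiFactorial_add_single (α : Fin n → ℕ) (i : Fin n) :
    multiFactorial (α + Pi.single i 1) = (α i + 1) * multiFactorial α := by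
  unfold multiFactorial
  rw [← Finset.mul_prod_erase _ _ (Finset.mem_univ i), ← Finset.mul_prod_erase _
    (fun i => (α i)!) (Finset.mem_univ i), ← mul_assoc]
  congr 1
  · simp [Nat.factorial_succ]
  · refine Finset.prod_congr rfl fun i' hi' => ?_
    simp [Finset.ne_of_mem_erase hi']

theorem multiFactorial_pos (α : Fin n → ℕ) : 0 < multiFactorial α :=
  Finset.prod_pos fun _ _ => Nat.factorial_pos _

/-- The two products share the factors at `x, …, x - b + 1`; the remaining ones differ by `h * ((x +
1) - (x - b))`. -/
theorem prod_range_add_one_sub (h x : ℝ) (b : ℕ) :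
    ∏ ℓ ∈ Finset.range (b + 1), h * (x + 1 - ℓ) - ∏ ℓ ∈ Finset.range (b + 1), h * (x - ℓ)
      = h * (b + 1) * ∏ ℓ ∈ Finset.range b, h * (x - ℓ) := by
  rw [Finset.prod_range_succ', Finset.prod_range_succ (fun ℓ : ℕ => h * (x - ℓ))]
  have : ∀ ℓ : ℕ, x + 1 - ((ℓ + 1 : ℕ) : ℝ) = x - ℓ := fun ℓ => by push_cast; ring
  simp only [this]
  push_cast
  ring

/-- Pascal's rule for the Newton basis. -/
theorem multiplier_add_single_sub (h : ℝ) (α : Fin n → ℕ) (i : Fin n) (j : HLattice n) :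
    multiplier h (α + Pi.single i 1) (j + Pi.single i 1) - multiplier h (α + Pi.single i 1) j
      = h * (α i + 1) * multiplier h α j := by
  have key := prod_range_add_one_sub h (j i) (α i)
  rw [multiplier_eq_mul_prod_erase h _ i, multiplier_eq_mul_prod_erase h _ i,
    multiplier_eq_mul_prod_erase h α i]
  have e1 : ∏ i' ∈ Finset.univ.erase i, ∏ ℓ ∈ Finset.range ((α + Pi.single i 1 : Fin n → ℕ) i'),
      h * (((j + Pi.single i 1 : HLattice n) i' : ℝ) - ℓ)
      = ∏ i' ∈ Finset.univ.erase i, ∏ ℓ ∈ Finset.range (α i'), h * ((j i' : ℝ) - ℓ) :=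
    Finset.prod_congr rfl fun i' hi' => by simp [Finset.ne_of_mem_erase hi']
  have e2 : ∏ i' ∈ Finset.univ.erase i, ∏ ℓ ∈ Finset.range ((α + Pi.single i 1 : Fin n → ℕ) i'),
      h * ((j i' : ℝ) - ℓ)
      = ∏ i' ∈ Finset.univ.erase i, ∏ ℓ ∈ Finset.range (α i'), h * ((j i' : ℝ) - ℓ) :=
    Finset.prod_congr rfl fun i' hi' => by simp [Finset.ne_of_mem_erase hi']
  rw [e1, e2, ← sub_mul, ← mul_assoc]
  congr 1
  simpa using key

theorem multiplier_add_single_of_eq_zero (h : ℝ) {α : Fin n → ℕ} {i : Fin n} (hi : α i = 0)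
    (j : HLattice n) : multiplier h α (j + Pi.single i 1) = multiplier h α j := by
  unfold multiplier
  refine Finset.prod_congr rfl fun i' _ => ?_
  rcases eq_or_ne i' i with rfl | hne
  · simp [hi]
  · simp [hne]

/-! ### Newton's formula with remainder -/

/-- The remainder of Newton's expansion of `g` about `k` at `k + j`, up to the order `M`. -/
def newtonRemainder (h : ℝ) (M : ℕ) (g : HLattice n → ℂ) (k j : HLattice n) : ℂ :=
  g (k + j) - ∑ α ∈ multiIndexLT n M,
    (multiplier h α j : ℂ) * ((1 / (multiFactorial α : ℂ)) * multiDiff h α g k)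

/-- Pascal's rule lowers the order by one and replaces `g` by its difference in direction `i`; this
recursion drives the remainder bound. -/
theorem newtonRemainder_add_single_sub (h : ℝ) (hpos : 0 < h) (M : ℕ) (g : HLattice n → ℂ)
    (k j : HLattice n) (i : Fin n) :
    newtonRemainder h (M + 1) g k (j + Pi.single i 1) - newtonRemainder h (M + 1) g k j
      = h * newtonRemainder h M (latticeDiff h i g) k j := by
  have hne : (h : ℂ) ≠ 0 := by exact_mod_cast hpos.ne'
  have hdiff : g (k + (j + Pi.single i 1)) - g (k + j)
      = h * latticeDiff h i g (k + j) := by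
    rw [latticeDiff, mul_div_cancel₀ _ hne, add_assoc]
  have hsum : ∑ α ∈ multiIndexLT n (M + 1),
        (((multiplier h α (j + Pi.single i 1) : ℂ) - multiplier h α j)
          * ((1 / (multiFactorial α : ℂ)) * multiDiff h α g k))
      = ∑ α ∈ multiIndexLT n M, h * ((multiplier h α j : ℂ)
          * ((1 / (multiFactorial α : ℂ)) * multiDiff h α (latticeDiff h i g) k)) := by
    symm
    refine Finset.sum_of_injOn (fun α => α + Pi.single i 1) (add_left_injective _).injOn
      ?_ ?_ ?_
    · intro α hα
      rw [Finset.mem_coe, mem_multiIndexLT] at hα ⊢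
      rw [order_add, order_single]
      omega
    -- The shift by the unit vector misses only indices with `α i = 0`; their multipliers do not
    -- involve `j i`, so their increments vanish.
    · intro α hα hα'
      have hi : α i = 0 := by
        by_contra hi
        obtain ⟨β, rfl⟩ := exists_eq_add_single hi
        rw [mem_multiIndexLT, order_add, order_single] at hα
        exact hα' ⟨β, (mem_multiIndexLT β).2 (by omega), rfl⟩
      rw [multiplier_add_single_of_eq_zero h hi, sub_self, zero_mul]
    · intro α _
      have hf : (multiFactorial α : ℂ) ≠ 0 := by exact_mod_cast (multiFactorial_pos α).ne'
      have hi : ((α i : ℂ) + 1) ≠ 0 := by exact_mod_cast (α i).succ_ne_zero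
      rw [← Complex.ofReal_sub, multiplier_add_single_sub, multiFactorial_add_single,
        multiDiff_add, multiDiff_single]
      push_cast
      field_simp
  simp only [newtonRemainder, mul_sub, Finset.mul_sum]
  rw [← hsum, ← hdiff]
  simp only [sub_mul, Finset.sum_sub_distrib]
  ring

/-- For `α ≠ 0` some product contains the factor `ℓ = 0`, which vanishes at the origin. -/
theorem newtonRemainder_zero_right (h : ℝ) (M : ℕ) (g : HLattice n → ℂ) (k : HLattice n) :
    newtonRemainder h (M + 1) g k 0 = 0 := by
  have h0 : ∀ α ∈ multiIndexLT n (M + 1), α ≠ 0 →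
      (multiplier h α (0 : HLattice n) : ℂ) * ((1 / (multiFactorial α : ℂ)) * multiDiff h α g k)
        = 0 := by
    intro α _ hα
    obtain ⟨i, hi⟩ := Function.ne_iff.1 hα
    obtain ⟨b, hb⟩ := Nat.exists_eq_succ_of_ne_zero hi
    rw [multiplier, Finset.prod_eq_zero (Finset.mem_univ i)]
    · simp
    · rw [hb, Nat.succ_eq_add_one, Finset.prod_range_succ']
      simp
  rw [newtonRemainder, Finset.sum_eq_single_of_mem 0
    ((mem_multiIndexLT 0).2 (by rw [order_zero]; omega)) h0, multiplier_zero, multiDiff_zero]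
  simp [multiFactorial]

theorem norm_le_of_natAbs_le {x y : HLattice n} (hxy : ∀ i, (x i).natAbs ≤ (y i).natAbs) :
    ‖x‖ ≤ ‖y‖ := by
  refine (pi_norm_le_iff_of_nonneg (norm_nonneg _)).2 fun i => ?_
  refine le_trans ?_ (norm_le_pi_norm y i)
  rw [Int.norm_eq_abs, Int.norm_eq_abs, ← Int.cast_abs, ← Int.cast_abs, Int.abs_eq_natAbs,
    Int.abs_eq_natAbs]
  exact_mod_cast hxy i

/-- A function on the lattice that vanishes at the origin and has increments of size at most `D`
within the box of radius `B` is at most `‖j‖₁ D` there. -/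
theorem norm_le_of_increments {u : HLattice n → ℂ} (h0 : u 0 = 0) {B D : ℝ}
    (hD : ∀ (i : Fin n) (j : HLattice n), ‖j‖ ≤ B → ‖u (j + Pi.single i 1) - u j‖ ≤ D)
    (j : HLattice n) (hj : ‖j‖ ≤ B) : ‖u j‖ ≤ (∑ i, (j i).natAbs : ℕ) * D := by
  induction hN : ∑ i, (j i).natAbs generalizing j with
  | zero =>
    have : j = 0 := by
      ext i
      simpa using (Finset.sum_eq_zero_iff.1 hN) i (Finset.mem_univ i)
    simp [this, h0]
  | succ N ih =>
    obtain ⟨i, hi⟩ : ∃ i, j i ≠ 0 := by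
      by_contra! hall
      simp [hall] at hN
    -- Here `j'` is one unit closer to the origin in direction `i`. The forward increment starts at
    -- `j` if `j i < 0` and at `j'` if `j i > 0`, hence the disjunction.
    have step : ∀ j' : HLattice n, (∀ i', i' ≠ i → j' i' = j i') →
        (j' i).natAbs + 1 = (j i).natAbs →
        ‖u j' - u j‖ ≤ D ∨ ‖u j - u j'‖ ≤ D → ‖u j‖ ≤ ((N + 1 : ℕ) : ℝ) * D := by
      intro j' hne heq hor
      have hle : ‖u j - u j'‖ ≤ D := hor.elim (fun hh => by rwa [norm_sub_rev]) id
      have hle' : ‖j'‖ ≤ B := (norm_le_of_natAbs_le fun i' => by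
        rcases eq_or_ne i' i with rfl | hi'
        · omega
        · rw [hne i' hi']).trans hj
      have hs : ∑ i, (j' i).natAbs = N := by
        rw [← Finset.add_sum_erase _ _ (Finset.mem_univ i)] at hN ⊢
        rw [Finset.sum_congr rfl fun i' hi' => by rw [hne i' (Finset.ne_of_mem_erase hi')]]
        omega
      have hN' := ih j' hle' hs
      calc ‖u j‖ = ‖u j' + (u j - u j')‖ := by rw [add_sub_cancel]
        _ ≤ N * D + D := (norm_add_le _ _).trans (add_le_add hN' hle)
        _ = ((N + 1 : ℕ) : ℝ) * D := by push_cast; ring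
    rcases lt_or_gt_of_ne hi with hneg | hpos
    · refine step (j + Pi.single i 1) (fun i' hi' => by simp [hi']) ?_ (Or.inl (hD i j hj))
      simp only [Pi.add_apply, Pi.single_eq_same]
      omega
    · have hab : (j i - 1).natAbs + 1 = (j i).natAbs := by omega
      refine step (j - Pi.single i 1) (fun i' hi' => by simp [hi']) (by simpa using hab)
        (Or.inr ?_)
      have := hD i (j - Pi.single i 1) ((norm_le_of_natAbs_le fun i' => by
        rcases eq_or_ne i' i with rfl | hi'
        · simp only [Pi.sub_apply, Pi.single_eq_same]; omega
        · simp [hi']).trans hj)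
      rwa [sub_add_cancel] at this

/-- A path of unit steps inside the box joins `0` to `j` in at most `n * B` steps, and each
increment is `h` times a remainder of lower order. Only differences of top order enter. -/
theorem norm_newtonRemainder_le (h : ℝ) (hpos : 0 < h) {B : ℝ} (M : ℕ)
    (g : HLattice n → ℂ) (k : HLattice n) {A : ℝ} (hA : 0 ≤ A)
    (hg : ∀ α : Fin n → ℕ, order α = M → ∀ t : HLattice n, ‖t‖ ≤ B →
      ‖multiDiff h α g (k + t)‖ ≤ A) (j : HLattice n) (hj : ‖j‖ ≤ B) :
    ‖newtonRemainder h M g k j‖ ≤ (h * (n * B)) ^ M * A := by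
  induction M generalizing g j with
  | zero =>
    have h0 : multiIndexLT n 0 = ∅ := Finset.eq_empty_of_forall_notMem fun α hα => by
      simp [mem_multiIndexLT] at hα
    simpa [newtonRemainder, h0, multiDiff_zero] using hg 0 order_zero j hj
  | succ M ih =>
    have hB : 0 ≤ B := (norm_nonneg j).trans hj
    refine (norm_le_of_increments (newtonRemainder_zero_right h M g k)
      (D := h * ((h * (n * B)) ^ M * A)) (fun i j hj => ?_) j hj).trans ?_
    · rw [newtonRemainder_add_single_sub h hpos, norm_mul, Complex.norm_real,
        Real.norm_of_nonneg hpos.le]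
      refine mul_le_mul_of_nonneg_left (ih _ (fun α hα t ht => ?_) j hj) hpos.le
      rw [← multiDiff_single, ← multiDiff_add]
      exact hg _ (by rw [order_add, order_single, hα]) t ht
    · have hs : ((∑ i, (j i).natAbs : ℕ) : ℝ) ≤ n * B := by
        push_cast
        refine (Finset.sum_le_card_nsmul _ _ B fun i _ => ?_).trans (by simp)
        have := (norm_le_pi_norm j i).trans hj
        rwa [Int.norm_eq_abs, ← Int.cast_abs, Int.abs_eq_natAbs] at this
      calc _ ≤ n * B * (h * ((h * (n * B)) ^ M * A)) :=
            mul_le_mul_of_nonneg_right hs (by positivity)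
        _ = _ := by ring

theorem multiIndexLT_zero (n : ℕ) : multiIndexLT n 0 = ∅ :=
  Finset.eq_empty_of_forall_notMem fun α hα => by simp [mem_multiIndexLT] at hα

/-! ### Smooth functions on the torus and their Fourier coefficients -/

/-- The projection `ℝⁿ → 𝕋ⁿ`. -/
def torusMk (x : Fin n → ℝ) : Torus n := fun j => (x j : UnitAddCircle)

theorem isOpenQuotientMap_torusMk : IsOpenQuotientMap (torusMk (n := n)) :=
  IsOpenQuotientMap.piMap fun _ => QuotientAddGroup.isOpenQuotientMap_mk

theorem torusMk_add_smul_single (x : Fin n → ℝ) (i : Fin n) (t : ℝ) :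
    torusMk (x + t • Pi.single i 1) = torusMk x + Pi.single i (t : UnitAddCircle) := by
  ext j
  rcases eq_or_ne j i with rfl | hj
  · simp [torusMk]
  · simp [torusMk, hj]

namespace IsSmoothOnTorus

variable {f g : Torus n → ℂ}

protected theorem continuous (hf : IsSmoothOnTorus f) : Continuous f :=
  isOpenQuotientMap_torusMk.isQuotientMap.continuous_iff.2 (ContDiff.continuous hf)

protected theorem integrable (hf : IsSmoothOnTorus f) : Integrable f :=
  hf.continuous.integrable_of_hasCompactSupport (HasCompactSupport.of_compactSpace f)

theorem exists_norm_le (hf : IsSmoothOnTorus f) : ∃ C : ℝ, ∀ θ, ‖f θ‖ ≤ C := by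
  obtain ⟨C, hC⟩ := isCompact_univ.exists_bound_of_continuousOn hf.continuous.continuousOn
  exact ⟨C, fun θ => hC θ (Set.mem_univ θ)⟩

protected theorem mul (hf : IsSmoothOnTorus f) (hg : IsSmoothOnTorus g) :
    IsSmoothOnTorus fun θ => f θ * g θ := ContDiff.mul hf hg

protected theorem sub (hf : IsSmoothOnTorus f) (hg : IsSmoothOnTorus g) :
    IsSmoothOnTorus fun θ => f θ - g θ := ContDiff.sub hf hg

protected theorem const_mul (c : ℂ) (hf : IsSmoothOnTorus f) :
    IsSmoothOnTorus fun θ => c * f θ := contDiff_const.mul hf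

protected theorem sum {ι : Type*} {s : Finset ι} {F : ι → Torus n → ℂ}
    (hF : ∀ v ∈ s, IsSmoothOnTorus (F v)) : IsSmoothOnTorus fun θ => ∑ v ∈ s, F v θ :=
  ContDiff.sum hF

end IsSmoothOnTorus

theorem latticeChar_torusMk (k : HLattice n) (x : Fin n → ℝ) :
    latticeChar k (torusMk x) = Complex.exp (2 * Real.pi * Complex.I * ∑ j, (k j : ℂ) * x j) := by
  rw [latticeChar, UnitAddTorus.mFourier, ContinuousMap.coe_mk, Finset.mul_sum, Complex.exp_sum]
  refine Finset.prod_congr rfl fun j _ => ?_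
  rw [torusMk, fourier_coe_apply]
  congr 1
  push_cast
  ring

theorem norm_latticeChar (k : HLattice n) (θ : Torus n) : ‖latticeChar k θ‖ = 1 := by
  rw [latticeChar, UnitAddTorus.mFourier, ContinuousMap.coe_mk, norm_prod]
  exact Finset.prod_eq_one fun i _ => Circle.norm_coe _

theorem latticeChar_add (k l : HLattice n) (θ : Torus n) :
    latticeChar (k + l) θ = latticeChar k θ * latticeChar l θ := UnitAddTorus.mFourier_add

theorem latticeChar_zero (θ : Torus n) : latticeChar (0 : HLattice n) θ = 1 := by
  rw [latticeChar, UnitAddTorus.mFourier_zero]; rfl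

theorem isSmoothOnTorus_latticeChar (k : HLattice n) : IsSmoothOnTorus (latticeChar k) := by
  have : (fun x : Fin n → ℝ => latticeChar k fun j => (x j : UnitAddCircle))
      = fun x => Complex.exp (2 * Real.pi * Complex.I * ∑ j, (k j : ℂ) * x j) :=
    funext (latticeChar_torusMk k)
  rw [IsSmoothOnTorus, this]
  refine Complex.contDiff_exp.comp (contDiff_const.mul (ContDiff.sum fun j _ =>
    contDiff_const.mul (Complex.ofRealCLM.contDiff.comp (contDiff_apply ℝ ℝ j))))

theorem torusPartial_torusMk {f : Torus n → ℂ} (hf : IsSmoothOnTorus f) (i : Fin n)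
    (x : Fin n → ℝ) :
    torusPartial i f (torusMk x) = fderiv ℝ (fun y => f (torusMk y)) x (Pi.single i 1) := by
  have hd : DifferentiableAt ℝ (fun y => f (torusMk y)) x :=
    (ContDiff.differentiable hf (by simp)) x
  rw [torusPartial, ← hd.lineDeriv_eq_fderiv, lineDeriv]
  simp only [torusMk_add_smul_single]

theorem hasDerivAt_torus {f : Torus n → ℂ} (hf : IsSmoothOnTorus f) (i : Fin n) (θ : Torus n)
    (t : ℝ) : HasDerivAt (fun t : ℝ => f (θ + Pi.single i (t : UnitAddCircle)))
      (torusPartial i f (θ + Pi.single i (t : UnitAddCircle))) t := by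
  obtain ⟨x, rfl⟩ := isOpenQuotientMap_torusMk.surjective θ
  simp only [← torusMk_add_smul_single]
  rw [torusPartial_torusMk hf]
  have hd : DifferentiableAt ℝ (fun y => f (torusMk y)) (x + t • Pi.single i 1) :=
    (ContDiff.differentiable hf (by simp)) _
  refine HasFDerivAt.comp_hasDerivAt (f := fun t : ℝ => x + t • Pi.single i 1) t hd.hasFDerivAt ?_
  simpa using ((hasDerivAt_id t).smul_const (Pi.single i 1 : Fin n → ℝ)).const_add x

theorem torusPartial_eq {f : Torus n → ℂ} {i : Fin n} {θ : Torus n} {c : ℂ}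
    (hc : HasDerivAt (fun t : ℝ => f (θ + Pi.single i (t : UnitAddCircle))) c 0) :
    torusPartial i f θ = c := hc.deriv

theorem hasDerivAt_torus_zero {f : Torus n → ℂ} (hf : IsSmoothOnTorus f) (i : Fin n)
    (θ : Torus n) : HasDerivAt (fun t : ℝ => f (θ + Pi.single i (t : UnitAddCircle)))
      (torusPartial i f θ) 0 := by
  simpa using hasDerivAt_torus hf i θ 0

theorem torusPartial_mul {f g : Torus n → ℂ} (hf : IsSmoothOnTorus f) (hg : IsSmoothOnTorus g)
    (i : Fin n) (θ : Torus n) : torusPartial i (fun θ => f θ * g θ) θ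
      = torusPartial i f θ * g θ + f θ * torusPartial i g θ :=
  torusPartial_eq (by
    simpa using (hasDerivAt_torus_zero hf i θ).fun_mul (hasDerivAt_torus_zero hg i θ))

theorem torusPartial_latticeChar (k : HLattice n) (i : Fin n) (θ : Torus n) :
    torusPartial i (latticeChar k) θ = 2 * Real.pi * Complex.I * k i * latticeChar k θ := by
  obtain ⟨x, rfl⟩ := isOpenQuotientMap_torusMk.surjective θ
  refine torusPartial_eq ?_
  simp only [← torusMk_add_smul_single, latticeChar_torusMk]
  have hsum : HasDerivAt (fun t : ℝ => ∑ j, (k j : ℂ) * ((x + t • Pi.single i 1 : Fin n → ℝ) j : ℝ))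
      (∑ j, (k j : ℂ) * ((Pi.single i 1 : Fin n → ℝ) j : ℝ)) 0 := by
    refine HasDerivAt.fun_sum fun j _ => HasDerivAt.const_mul _ (HasDerivAt.ofReal_comp ?_)
    simpa using ((hasDerivAt_id (0 : ℝ)).mul_const ((Pi.single i 1 : Fin n → ℝ) j)).const_add (x j)
  have := (hsum.const_mul (2 * Real.pi * Complex.I)).cexp
  convert this using 1
  have e : ∑ j, (k j : ℂ) * ((Pi.single i 1 : Fin n → ℝ) j : ℝ) = k i := by
    rw [Finset.sum_eq_single i (fun j _ hj => by simp [hj]) (by simp)]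
    simp
  rw [e]
  simp
  ring

theorem isSmoothOnTorus_torusPartial {f : Torus n → ℂ} (hf : IsSmoothOnTorus f) (i : Fin n) :
    IsSmoothOnTorus (torusPartial i f) := by
  have : (fun x : Fin n → ℝ => torusPartial i f fun j => (x j : UnitAddCircle))
      = fun x => fderiv ℝ (fun y => f (torusMk y)) x (Pi.single i 1) :=
    funext (torusPartial_torusMk hf i)
  rw [IsSmoothOnTorus, this]
  exact (ContDiff.fderiv_right (m := ∞) hf (by simp)).clm_apply contDiff_const

theorem integral_add_single (f : Torus n → ℂ) (i : Fin n) (t : ℝ) :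
    ∫ θ : Torus n, f (θ + Pi.single i (t : UnitAddCircle)) = ∫ θ, f θ := by
  have : Measure.IsAddRightInvariant (volume : Measure (Torus n)) := inferInstance
  exact integral_add_right_eq_self f (Pi.single i (t : UnitAddCircle) : Torus n)

/-- The integral of a translate of `f` in direction `i` does not depend on the translation; its
derivative, taken under the integral, is therefore zero. -/
theorem integral_torusPartial {f : Torus n → ℂ} (hf : IsSmoothOnTorus f) (i : Fin n) :
    ∫ θ, torusPartial i f θ = 0 := by
  obtain ⟨C, hC⟩ := (isSmoothOnTorus_torusPartial hf i).exists_norm_le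
  have hcont : ∀ (g : Torus n → ℂ), Continuous g → ∀ t : ℝ,
      Continuous fun θ : Torus n => g (θ + Pi.single i (t : UnitAddCircle)) := by
    intro g hg t
    exact hg.comp (continuous_add_const (Pi.single i (t : UnitAddCircle) : Torus n))
  have hmeas : ∀ t : ℝ, AEStronglyMeasurable
      (fun θ : Torus n => f (θ + Pi.single i (t : UnitAddCircle))) volume :=
    fun t => (hcont f hf.continuous t).aestronglyMeasurable
  have hmeas' : AEStronglyMeasurable
      (fun θ : Torus n => torusPartial i f (θ + Pi.single i ((0 : ℝ) : UnitAddCircle))) volume :=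
    (hcont _ (isSmoothOnTorus_torusPartial hf i).continuous 0).aestronglyMeasurable
  have hint : Integrable
      (fun θ : Torus n => f (θ + Pi.single i ((0 : ℝ) : UnitAddCircle))) volume :=
    (hcont f hf.continuous 0).integrable_of_hasCompactSupport (HasCompactSupport.of_compactSpace _)
  have hbound : ∀ᵐ θ : Torus n, ∀ t ∈ (Set.univ : Set ℝ),
      ‖torusPartial i f (θ + Pi.single i (t : UnitAddCircle))‖ ≤ C :=
    Filter.Eventually.of_forall fun θ t _ => hC _
  have hderiv : ∀ᵐ θ : Torus n, ∀ t ∈ (Set.univ : Set ℝ),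
      HasDerivAt (fun t : ℝ => f (θ + Pi.single i (t : UnitAddCircle)))
        (torusPartial i f (θ + Pi.single i (t : UnitAddCircle))) t :=
    Filter.Eventually.of_forall fun θ t _ => hasDerivAt_torus hf i θ t
  have key := (hasDerivAt_integral_of_dominated_loc_of_deriv_le Filter.univ_mem
    (Filter.Eventually.of_forall hmeas) hint hmeas' hbound (integrable_const C) hderiv).2
  simp only [integral_add_single] at key
  exact key.unique (hasDerivAt_const 0 _)

theorem mFourierCoeff_torusPartial {f : Torus n → ℂ} (hf : IsSmoothOnTorus f) (i : Fin n)
    (j : HLattice n) : UnitAddTorus.mFourierCoeff (torusPartial i f) j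
      = 2 * Real.pi * Complex.I * j i * UnitAddTorus.mFourierCoeff f j := by
  have hχ := isSmoothOnTorus_latticeChar (-j)
  have h0 := integral_torusPartial (hχ.mul hf) i
  simp only [torusPartial_mul hχ hf, torusPartial_latticeChar] at h0
  rw [integral_add] at h0
  · rw [mFourierCoeff_eq_integral_latticeChar, mFourierCoeff_eq_integral_latticeChar,
      eq_neg_of_add_eq_zero_right h0, ← integral_neg, ← integral_const_mul]
    congr 1
    ext θ
    push_cast [Pi.neg_apply]
    ring
  · exact ((hχ.const_mul _).mul hf).integrable
  · exact (hχ.mul (isSmoothOnTorus_torusPartial hf i)).integrable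

theorem norm_mFourierCoeff_le {f : Torus n → ℂ} {S : ℝ} (hS : ∀ θ, ‖f θ‖ ≤ S) (j : HLattice n) :
    ‖UnitAddTorus.mFourierCoeff f j‖ ≤ S := by
  rw [mFourierCoeff_eq_integral_latticeChar]
  refine (norm_integral_le_of_norm_le_const (C := S)
    (Filter.Eventually.of_forall fun θ => ?_)).trans (by simp)
  rw [norm_mul, norm_latticeChar, one_mul]
  exact hS θ

theorem mFourierCoeff_sum {ι : Type*} {s : Finset ι} {F : ι → Torus n → ℂ} (c : ι → ℂ)
    (hF : ∀ v ∈ s, IsSmoothOnTorus (F v)) (j : HLattice n) :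
    UnitAddTorus.mFourierCoeff (fun θ => ∑ v ∈ s, c v * F v θ) j
      = ∑ v ∈ s, c v * UnitAddTorus.mFourierCoeff (F v) j := by
  simp only [mFourierCoeff_eq_integral_latticeChar, Finset.mul_sum]
  rw [integral_finsetSum]
  · refine Finset.sum_congr rfl fun v _ => ?_
    rw [← integral_const_mul]
    congr 1
    ext θ
    ring
  · exact fun v hv => ((isSmoothOnTorus_latticeChar (-j)).mul ((hF v hv).const_mul _)).integrable

theorem norm_le_tsum_mFourierCoeff {f : Torus n → ℂ} (hf : IsSmoothOnTorus f)
    (hs : Summable fun j => ‖UnitAddTorus.mFourierCoeff f j‖) (θ : Torus n) :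
    ‖f θ‖ ≤ ∑' j, ‖UnitAddTorus.mFourierCoeff f j‖ := by
  have h := UnitAddTorus.hasSum_mFourier_series_apply_of_summable (f := ⟨f, hf.continuous⟩)
    hs.of_norm θ
  have hn : ∀ j, ‖UnitAddTorus.mFourierCoeff f j • UnitAddTorus.mFourier j θ‖
      = ‖UnitAddTorus.mFourierCoeff f j‖ := fun j => by
    rw [norm_smul, ← latticeChar, norm_latticeChar, mul_one]
  rw [show f θ = _ from h.tsum_eq.symm]
  refine (norm_tsum_le_tsum_norm ?_).trans_eq (tsum_congr hn)
  exact hs.congr fun j => (hn j).symm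

/-- The difference has vanishing, hence summable, coefficients and equals its Fourier series.
Operator identities can thus be checked frequency by frequency. -/
theorem eq_of_mFourierCoeff_eq {f g : Torus n → ℂ} (hf : IsSmoothOnTorus f)
    (hg : IsSmoothOnTorus g)
    (h : ∀ j, UnitAddTorus.mFourierCoeff f j = UnitAddTorus.mFourierCoeff g j) : f = g := by
  have hz : ∀ j, UnitAddTorus.mFourierCoeff (fun θ => f θ - g θ) j = 0 := fun j => by
    simp only [mFourierCoeff_eq_integral_latticeChar, mul_sub] at h ⊢
    have hχ := isSmoothOnTorus_latticeChar (-j)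
    rw [integral_sub (hχ.mul hf).integrable (hχ.mul hg).integrable, h j, sub_self]
  ext θ
  have := norm_le_tsum_mFourierCoeff (hf.sub hg) (by simp [hz]) θ
  simp only [hz, norm_zero, tsum_zero] at this
  exact sub_eq_zero.1 (norm_le_zero_iff.1 this)

theorem mFourierCoeff_const_mul_sub {f g : Torus n → ℂ} (hf : IsSmoothOnTorus f)
    (hg : IsSmoothOnTorus g) (a b : ℂ) (j : HLattice n) :
    UnitAddTorus.mFourierCoeff (fun θ => a * f θ - b * g θ) j
      = a * UnitAddTorus.mFourierCoeff f j - b * UnitAddTorus.mFourierCoeff g j := by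
  have hχ := isSmoothOnTorus_latticeChar (-j)
  simp only [mFourierCoeff_eq_integral_latticeChar, mul_sub, mul_left_comm _ a, mul_left_comm _ b]
  rw [integral_sub ((hχ.mul hf).const_mul a).integrable ((hχ.mul hg).const_mul b).integrable,
    integral_const_mul, integral_const_mul]

/-! ### The operators `D^{(β)}` as Fourier multipliers -/

theorem torusD_succ (h : ℝ) (i : Fin n) (b : ℕ) (f : Torus n → ℂ) :
    torusD h i (b + 1) f = fun θ => h * (2 * (Real.pi : ℂ) * Complex.I)⁻¹
      * torusPartial i (torusD h i b f) θ - h * b * torusD h i b f θ := by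
  ext θ
  rw [torusD]
  ring

theorem isSmoothOnTorus_torusD {f : Torus n → ℂ} (hf : IsSmoothOnTorus f) (h : ℝ) (i : Fin n) :
    ∀ b : ℕ, IsSmoothOnTorus (torusD h i b f)
  | 0 => hf
  | b + 1 => by
    have ih := isSmoothOnTorus_torusD hf h i b
    rw [torusD_succ]
    exact ((isSmoothOnTorus_torusPartial ih i).const_mul _).sub (ih.const_mul _)

theorem mFourierCoeff_torusD {f : Torus n → ℂ} (hf : IsSmoothOnTorus f) (h : ℝ) (i : Fin n)
    (j : HLattice n) : ∀ b : ℕ, UnitAddTorus.mFourierCoeff (torusD h i b f) j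
      = (∏ ℓ ∈ Finset.range b, h * ((j i : ℝ) - ℓ) : ℝ) * UnitAddTorus.mFourierCoeff f j
  | 0 => by simp [torusD]
  | b + 1 => by
    have ih := isSmoothOnTorus_torusD hf h i b
    have hpi : 2 * (Real.pi : ℂ) * Complex.I ≠ 0 := Complex.two_pi_I_ne_zero
    rw [torusD_succ, mFourierCoeff_const_mul_sub (isSmoothOnTorus_torusPartial ih i) ih,
      mFourierCoeff_torusPartial ih, mFourierCoeff_torusD hf h i j b, Finset.prod_range_succ]
    push_cast
    field_simp

theorem isSmoothOnTorus_multiD {f : Torus n → ℂ} (hf : IsSmoothOnTorus f) (h : ℝ)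
    (β : Fin n → ℕ) : IsSmoothOnTorus (multiD h β f) := by
  unfold multiD
  induction List.finRange n with
  | nil => exact hf
  | cons i l ih => exact isSmoothOnTorus_torusD ih h i _

/-- This is the link to Newton's formula: the multiplier is the Newton basis function. Smoothness is
carried through the fold because each factor requires it. -/
theorem mFourierCoeff_multiD {f : Torus n → ℂ} (hf : IsSmoothOnTorus f) (h : ℝ)
    (β : Fin n → ℕ) (j : HLattice n) : UnitAddTorus.mFourierCoeff (multiD h β f) j
      = multiplier h β j * UnitAddTorus.mFourierCoeff f j := by
  have hl : ∀ l : List (Fin n),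
      IsSmoothOnTorus (l.foldr (fun j f' => torusD h j (β j) f') f) ∧
      UnitAddTorus.mFourierCoeff (l.foldr (fun j f' => torusD h j (β j) f') f) j
        = ((l.map fun i => ∏ ℓ ∈ Finset.range (β i), h * ((j i : ℝ) - ℓ)).prod : ℝ)
          * UnitAddTorus.mFourierCoeff f j := by
    intro l
    induction l with
    | nil => simpa using hf
    | cons i l ih =>
      refine ⟨isSmoothOnTorus_torusD ih.1 h i _, ?_⟩
      rw [List.foldr_cons, mFourierCoeff_torusD ih.1, ih.2, List.map_cons, List.prod_cons]
      push_cast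
      ring
  rw [multiD, (hl _).2, multiplier, Fin.prod_univ_def]

theorem multiD_zero {f : Torus n → ℂ} (hf : IsSmoothOnTorus f) (h : ℝ) : multiD h 0 f = f :=
  eq_of_mFourierCoeff_eq (isSmoothOnTorus_multiD hf h 0) hf fun j => by
    rw [mFourierCoeff_multiD hf, multiplier_zero, Complex.ofReal_one, one_mul]

theorem multiD_sum {ι : Type*} {s : Finset ι} {F : ι → Torus n → ℂ} (c : ι → ℂ)
    (hF : ∀ v ∈ s, IsSmoothOnTorus (F v)) (h : ℝ) (β : Fin n → ℕ) :
    multiD h β (fun θ => ∑ v ∈ s, c v * F v θ) = fun θ => ∑ v ∈ s, c v * multiD h β (F v) θ := by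
  have hs : IsSmoothOnTorus fun θ => ∑ v ∈ s, c v * F v θ :=
    IsSmoothOnTorus.sum fun v hv => (hF v hv).const_mul _
  have hD : ∀ v ∈ s, IsSmoothOnTorus (multiD h β (F v)) :=
    fun v hv => isSmoothOnTorus_multiD (hF v hv) h β
  refine eq_of_mFourierCoeff_eq (isSmoothOnTorus_multiD hs h β)
    (IsSmoothOnTorus.sum fun v hv => (hD v hv).const_mul _) fun j => ?_
  rw [mFourierCoeff_multiD hs, mFourierCoeff_sum c hF, mFourierCoeff_sum c hD, Finset.mul_sum]
  refine Finset.sum_congr rfl fun v hv => ?_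
  rw [mFourierCoeff_multiD (hF v hv)]
  ring

theorem multiD_sub {f g : Torus n → ℂ} (hf : IsSmoothOnTorus f) (hg : IsSmoothOnTorus g) (h : ℝ)
    (β : Fin n → ℕ) :
    multiD h β (fun θ => f θ - g θ) = fun θ => multiD h β f θ - multiD h β g θ := by
  have := multiD_sum (s := Finset.univ) (F := fun b : Bool => if b then f else g)
    (fun b => if b then 1 else -1) (by simp [hf, hg]) h β
  simpa [← sub_eq_add_neg] using this

/-- The composition rule for the operators `D_h^{(α)}`. -/
theorem multiD_add_single_multiD {f : Torus n → ℂ} (hf : IsSmoothOnTorus f) (h : ℝ)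
    (α β : Fin n → ℕ) (i : Fin n) (θ : Torus n) :
    multiD h (α + Pi.single i 1) (multiD h β f) θ
      = multiD h α (multiD h (β + Pi.single i 1) f) θ
        - (h * ((α i : ℂ) - β i)) * multiD h α (multiD h β f) θ := by
  have hs := fun α β => isSmoothOnTorus_multiD (isSmoothOnTorus_multiD hf h β) h α
  have hc := fun α β j => mFourierCoeff_multiD (isSmoothOnTorus_multiD hf h β) h α j
  have key : multiD h (α + Pi.single i 1) (multiD h β f)
      = fun θ => 1 * multiD h α (multiD h (β + Pi.single i 1) f) θ
        - (h * ((α i : ℂ) - β i)) * multiD h α (multiD h β f) θ := by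
    -- On coefficients this is `h(jᵢ - αᵢ) = h(jᵢ - βᵢ) - h(αᵢ - βᵢ)`.
    refine eq_of_mFourierCoeff_eq (hs _ _) (((hs _ _).const_mul _).sub ((hs _ _).const_mul _))
      fun j => ?_
    rw [mFourierCoeff_const_mul_sub (hs _ _) (hs _ _)]
    simp only [hc, mFourierCoeff_multiD hf, multiplier_add_single]
    push_cast
    ring
  simp only [key, one_mul]

/-! ### Growth of multipliers and decay of coefficients -/

theorem abs_multiplier_le {h : ℝ} (hpos : 0 < h) (α : Fin n → ℕ) :
    ∃ C : ℝ, 0 ≤ C ∧ ∀ j : HLattice n, |multiplier h α j| ≤ C * weight j ^ (order α : ℝ) := by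
  induction α using multiIndex_induction with
  | zero => exact ⟨1, zero_le_one, fun j => by simp [multiplier_zero, order_zero]⟩
  | add_single α i ih =>
    obtain ⟨C, hC, hb⟩ := ih
    refine ⟨h * (1 + α i) * C, by positivity, fun j => ?_⟩
    have hj : |(j i : ℝ) - α i| ≤ (1 + α i) * weight j := by
      have h1 := norm_le_pi_norm j i
      rw [Int.norm_eq_abs] at h1
      have h2 := abs_sub (j i : ℝ) (α i)
      rw [abs_of_nonneg (Nat.cast_nonneg (α i) : (0 : ℝ) ≤ α i)] at h2
      unfold weight
      nlinarith [mul_nonneg (Nat.cast_nonneg (α i) : (0 : ℝ) ≤ α i) (norm_nonneg j)]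
    rw [multiplier_add_single, abs_mul, abs_mul, abs_of_pos hpos, order_add, order_single,
      Nat.cast_add, Nat.cast_one, Real.rpow_add (weight_pos j), Real.rpow_one]
    calc h * |(j i : ℝ) - α i| * |multiplier h α j|
        ≤ h * ((1 + α i) * weight j) * (C * weight j ^ (order α : ℝ)) :=
          mul_le_mul (mul_le_mul_of_nonneg_left hj hpos.le) (hb j) (abs_nonneg _)
            (mul_nonneg hpos.le ((abs_nonneg _).trans hj))
      _ = _ := by ring

theorem one_add_abs_pow_le {h : ℝ} (hpos : 0 < h) (L : ℕ) : ∃ C : ℝ, 0 ≤ C ∧ ∀ x : ℤ,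
    (1 + |(x : ℝ)|) ^ L ≤ C * (1 + |∏ ℓ ∈ Finset.range L, h * ((x : ℝ) - ℓ)|) := by
  -- The first summand covers `|x| ≤ 2L`. Beyond that, `|x - ℓ| ≥ |x|/2 ≥ (1 + |x|)/4` for `ℓ ≤ L`.
  refine ⟨(1 + 2 * L) ^ L + (4 / h) ^ L, by positivity, fun x => ?_⟩
  have hA : (0 : ℝ) ≤ (1 + 2 * L) ^ L := by positivity
  have hB : (0 : ℝ) ≤ (4 / h) ^ L := by positivity
  have hP := abs_nonneg (∏ ℓ ∈ Finset.range L, h * ((x : ℝ) - ℓ))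
  rcases le_or_gt |(x : ℝ)| (2 * L) with hx | hx
  · have : (1 + |(x : ℝ)|) ^ L ≤ (1 + 2 * L) ^ L := by gcongr
    nlinarith [mul_nonneg hA hP, mul_nonneg hB hP]
  · have hx1 : (1 : ℝ) ≤ |(x : ℝ)| := by
      have : x ≠ 0 := by
        rintro rfl
        simp at hx
        linarith [(Nat.cast_nonneg L : (0 : ℝ) ≤ L)]
      exact_mod_cast Int.one_le_abs this
    have hprod : (h * (1 + |(x : ℝ)|) / 4) ^ L ≤ |∏ ℓ ∈ Finset.range L, h * ((x : ℝ) - ℓ)| := by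
      rw [Finset.abs_prod]
      calc (h * (1 + |(x : ℝ)|) / 4) ^ L
          = ∏ _ℓ ∈ Finset.range L, (h * (1 + |(x : ℝ)|) / 4) := by
            rw [Finset.prod_const, Finset.card_range]
        _ ≤ _ := Finset.prod_le_prod (fun _ _ => by positivity) fun ℓ hℓ => by
          have hℓ' : (ℓ : ℝ) ≤ L := by exact_mod_cast (Finset.mem_range.1 hℓ).le
          have h2 := abs_sub_abs_le_abs_sub (x : ℝ) ℓ
          rw [abs_of_nonneg (Nat.cast_nonneg ℓ : (0 : ℝ) ≤ ℓ)] at h2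
          rw [abs_mul, abs_of_pos hpos, mul_div_assoc]
          refine mul_le_mul_of_nonneg_left ?_ hpos.le
          linarith
    have : (1 + |(x : ℝ)|) ^ L = (4 / h) ^ L * (h * (1 + |(x : ℝ)|) / 4) ^ L := by
      rw [← mul_pow, div_mul_div_cancel₀' four_ne_zero, mul_div_cancel_left₀ _ hpos.ne']
    rw [this]
    nlinarith [mul_le_mul_of_nonneg_left hprod hB, mul_nonneg hA hP]

/-- Decay of the Fourier coefficients of a smooth function. -/
theorem weight_pow_mul_mFourierCoeff_le {h : ℝ} (hpos : 0 < h) (n L : ℕ) :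
    ∃ C : ℝ, 0 ≤ C ∧ ∀ (f : Torus n → ℂ), IsSmoothOnTorus f → ∀ S : ℝ, (∀ θ, ‖f θ‖ ≤ S) →
      (∀ i θ, ‖multiD h (Pi.single i L) f θ‖ ≤ S) → ∀ j : HLattice n,
        weight j ^ (L : ℝ) * ‖UnitAddTorus.mFourierCoeff f j‖ ≤ C * S := by
  obtain ⟨C, hC, hb⟩ := one_add_abs_pow_le hpos L
  refine ⟨1 + 2 * C, by positivity, fun f hf S hS hD j => ?_⟩
  have hS0 : 0 ≤ S := (norm_nonneg _).trans (hS 0)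
  have h0 := norm_mFourierCoeff_le hS j
  rw [Real.rpow_natCast]
  rcases isEmpty_or_nonempty (Fin n) with hn | hn
  · have : weight j = 1 := by simp [weight, Subsingleton.elim j 0]
    rw [this, one_pow, one_mul]
    nlinarith [mul_nonneg hC hS0]
  -- The coordinate of largest modulus realises the weight, so `L` derivatives in that one direction
  -- suffice.
  · obtain ⟨i, hi⟩ := Finite.exists_max fun i => ‖j i‖
    have hw : weight j ≤ 1 + |(j i : ℝ)| := by
      unfold weight
      rw [← Int.norm_eq_abs]
      exact add_le_add_right ((pi_norm_le_iff_of_nonneg (norm_nonneg _)).2 hi) 1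
    have hm : multiplier h (Pi.single i L) j = ∏ ℓ ∈ Finset.range L, h * ((j i : ℝ) - ℓ) := by
      rw [multiplier, Finset.prod_eq_single i (fun i' _ hi' => by simp [hi']) (by simp)]
      simp
    have h1 := norm_mFourierCoeff_le (hD i) j
    rw [mFourierCoeff_multiD hf, norm_mul, Complex.norm_real, Real.norm_eq_abs, hm] at h1
    have hpow : weight j ^ L ≤ C * (1 + |∏ ℓ ∈ Finset.range L, h * ((j i : ℝ) - ℓ)|) :=
      (pow_le_pow_left₀ (weight_pos j).le hw L).trans (hb (j i))
    calc weight j ^ L * ‖UnitAddTorus.mFourierCoeff f j‖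
        ≤ C * (1 + |∏ ℓ ∈ Finset.range L, h * ((j i : ℝ) - ℓ)|)
            * ‖UnitAddTorus.mFourierCoeff f j‖ := mul_le_mul_of_nonneg_right hpow (norm_nonneg _)
      _ = C * (‖UnitAddTorus.mFourierCoeff f j‖ + |∏ ℓ ∈ Finset.range L, h * ((j i : ℝ) - ℓ)|
            * ‖UnitAddTorus.mFourierCoeff f j‖) := by ring
      _ ≤ C * (S + S) := mul_le_mul_of_nonneg_left (add_le_add h0 h1) hC
      _ ≤ (1 + 2 * C) * S := by linarith

/-! ### Trigonometric series with rapidly decreasing coefficients -/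

theorem iteratedDeriv_exp_mul_I (m : ℕ) : iteratedDeriv m (fun t : ℝ => Complex.exp (t * Complex.I))
    = fun t : ℝ => Complex.I ^ m * Complex.exp (t * Complex.I) := by
  induction m with
  | zero => simp
  | succ m ih =>
    ext t
    rw [iteratedDeriv_succ, ih]
    have h1 : HasDerivAt (fun t : ℝ => (t : ℂ) * Complex.I) (1 * Complex.I) t :=
      (Complex.ofRealCLM.hasDerivAt (x := t)).mul_const Complex.I
    rw [(h1.cexp.const_mul (Complex.I ^ m)).deriv]
    ring

/-- The character is `t ↦ exp(it)`, whose derivatives are unimodular, composed with a linear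
functional of norm at most `2πn * weight j`. -/
theorem norm_iteratedFDeriv_latticeChar_le (j : HLattice n) (m : ℕ) (x : Fin n → ℝ) :
    ‖iteratedFDeriv ℝ m (fun x => latticeChar j (torusMk x)) x‖
      ≤ (2 * Real.pi * n) ^ m * weight j ^ m := by
  let A : (Fin n → ℝ) →L[ℝ] ℝ :=
    ∑ i, (2 * Real.pi * (j i : ℝ)) • ContinuousLinearMap.proj i
  have hA : ‖A‖ ≤ 2 * Real.pi * n * weight j := by
    refine (norm_sum_le _ _).trans ((Finset.sum_le_card_nsmul _ _
      (2 * Real.pi * weight j) fun i _ => ?_).trans_eq (by simp; ring))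
    rw [norm_smul]
    have h1 : ‖(ContinuousLinearMap.proj i : (Fin n → ℝ) →L[ℝ] ℝ)‖ ≤ 1 :=
      ContinuousLinearMap.opNorm_le_bound _ zero_le_one fun y => by
        simpa using norm_le_pi_norm y i
    have h2 : ‖2 * Real.pi * (j i : ℝ)‖ ≤ 2 * Real.pi * weight j := by
      rw [norm_mul, Real.norm_of_nonneg (by positivity)]
      refine mul_le_mul_of_nonneg_left ?_ (by positivity)
      have := norm_le_pi_norm j i
      rw [Int.norm_eq_abs] at this
      rw [Real.norm_eq_abs, weight]
      linarith
    calc _ ≤ 2 * Real.pi * weight j * 1 :=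
          mul_le_mul h2 h1 (norm_nonneg _) ((norm_nonneg _).trans h2)
      _ = _ := mul_one _
  have heq : (fun x => latticeChar j (torusMk x))
      = (fun t : ℝ => Complex.exp (t * Complex.I)) ∘ A := by
    ext x
    rw [latticeChar_torusMk, Function.comp_apply]
    congr 1
    simp only [A, sum_apply, smul_apply, ContinuousLinearMap.proj_apply, smul_eq_mul]
    push_cast
    rw [Finset.sum_mul, Finset.mul_sum]
    exact Finset.sum_congr rfl fun i _ => by ring
  have hsm : ContDiff ℝ m fun t : ℝ => Complex.exp (t * Complex.I) :=
    Complex.contDiff_exp.comp (Complex.ofRealCLM.contDiff.mul contDiff_const)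
  rw [heq, A.iteratedFDeriv_comp_right hsm x le_rfl]
  refine (ContinuousMultilinearMap.norm_compContinuousLinearMap_le _ _).trans ?_
  rw [norm_iteratedFDeriv_eq_norm_iteratedDeriv, iteratedDeriv_exp_mul_I, norm_mul, norm_pow,
    Complex.norm_I, one_pow, Complex.norm_exp_ofReal_mul_I, one_mul, one_mul, Finset.prod_const,
    Finset.card_univ, Fintype.card_fin, ← mul_pow]
  exact pow_le_pow_left₀ (norm_nonneg _) hA m

/-- A trigonometric series with rapidly decreasing coefficients is smooth. -/
theorem isSmoothOnTorus_tsum {b : HLattice n → ℂ}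
    (hb : ∀ m : ℕ, Summable fun j => ‖b j‖ * weight j ^ m) :
    IsSmoothOnTorus fun θ => ∑' j, b j * latticeChar j θ := by
  refine contDiff_tsum (v := fun m j => (2 * Real.pi * n) ^ m * (‖b j‖ * weight j ^ m))
    (fun j => ((isSmoothOnTorus_latticeChar j).const_mul (b j))) (fun m _ => (hb m).mul_left _)
    fun m j x _ => ?_
  have hχ : ContDiffAt ℝ m (fun x : Fin n → ℝ => latticeChar j (torusMk x)) x :=
    (ContDiff.of_le (isSmoothOnTorus_latticeChar j) (by exact_mod_cast le_top)).contDiffAt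
  have : iteratedFDeriv ℝ m (fun x : Fin n → ℝ => b j * latticeChar j (torusMk x)) x
      = b j • iteratedFDeriv ℝ m (fun x => latticeChar j (torusMk x)) x :=
    iteratedFDeriv_const_smul_apply (a := b j) hχ
  change ‖iteratedFDeriv ℝ m (fun x : Fin n → ℝ => b j * latticeChar j (torusMk x)) x‖ ≤ _
  rw [this, norm_smul]
  calc _ ≤ ‖b j‖ * ((2 * Real.pi * n) ^ m * weight j ^ m) :=
        mul_le_mul_of_nonneg_left (norm_iteratedFDeriv_latticeChar_le j m x) (norm_nonneg _)
    _ = _ := by ring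

theorem integral_latticeChar (j : HLattice n) :
    ∫ θ : Torus n, latticeChar j θ = if j = 0 then 1 else 0 := by
  split_ifs with hj
  · simp [hj, latticeChar_zero]
  · obtain ⟨i, hi⟩ := Function.ne_iff.1 hj
    have h0 := integral_torusPartial (isSmoothOnTorus_latticeChar j) i
    simp only [torusPartial_latticeChar] at h0
    rw [integral_const_mul] at h0
    refine (mul_eq_zero.1 h0).resolve_left (mul_ne_zero Complex.two_pi_I_ne_zero ?_)
    exact_mod_cast hi

theorem mFourierCoeff_tsum {b : HLattice n → ℂ} (hb : Summable fun j => ‖b j‖) (j : HLattice n) :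
    UnitAddTorus.mFourierCoeff (fun θ => ∑' j, b j * latticeChar j θ) j = b j := by
  rw [mFourierCoeff_eq_integral_latticeChar]
  have hint : ∀ l, Integrable fun θ : Torus n => b l * latticeChar (l - j) θ := fun l =>
    ((isSmoothOnTorus_latticeChar (l - j)).const_mul (b l)).integrable
  have hsum := hasSum_integral_of_summable_integral_norm hint (by
    simpa [norm_latticeChar] using hb)
  have e : ∀ θ : Torus n, latticeChar (-j) θ * ∑' l, b l * latticeChar l θ
      = ∑' l, b l * latticeChar (l - j) θ := fun θ => by
    rw [← tsum_mul_left]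
    refine tsum_congr fun l => ?_
    rw [sub_eq_add_neg, latticeChar_add]
    ring
  simp only [e]
  rw [← hsum.tsum_eq]
  simp only [integral_const_mul, integral_latticeChar]
  rw [tsum_eq_single j fun l hl => by rw [if_neg (sub_ne_zero.2 hl), mul_zero]]
  simp

/-! ### Commutation of differences, derivatives and coefficients -/

theorem multiDiff_comm (h : ℝ) (α β : Fin n → ℕ) (b : HLattice n → HLattice n → ℂ)
    (k l : HLattice n) : multiDiff h α (fun k' => multiDiff h β (fun l' => b k' l') l) k
      = multiDiff h β (fun l' => multiDiff h α (fun k' => b k' l') k) l := by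
  obtain ⟨s, c, hc⟩ := exists_multiDiff_eq_sum h α
  obtain ⟨t, d, hd⟩ := exists_multiDiff_eq_sum h β
  simp only [hc, hd, Finset.mul_sum]
  rw [Finset.sum_comm]
  exact Finset.sum_congr rfl fun _ _ => Finset.sum_congr rfl fun _ _ => by ring

theorem multiDiff_shift (h : ℝ) (α : Fin n → ℕ) (g : HLattice n → ℂ) (v k : HLattice n) :
    multiDiff h α (fun k' => g (k' + v)) k = multiDiff h α g (k + v) := by
  obtain ⟨s, c, hc⟩ := exists_multiDiff_eq_sum h α
  simp only [hc, add_right_comm]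

theorem multiDiff_sum {ι : Type*} (h : ℝ) (α : Fin n → ℕ) (s : Finset ι) (c : ι → ℂ)
    (g : ι → HLattice n → ℂ) (k : HLattice n) :
    multiDiff h α (fun k' => ∑ v ∈ s, c v * g v k') k = ∑ v ∈ s, c v * multiDiff h α (g v) k := by
  obtain ⟨t, d, hd⟩ := exists_multiDiff_eq_sum h α
  simp only [hd, Finset.mul_sum]
  rw [Finset.sum_comm]
  exact Finset.sum_congr rfl fun _ _ => Finset.sum_congr rfl fun _ _ => by ring

theorem multiDiff_const_mul (h : ℝ) (α : Fin n → ℕ) (c : ℂ) (g : HLattice n → ℂ)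
    (k : HLattice n) : multiDiff h α (fun k' => c * g k') k = c * multiDiff h α g k := by
  simpa using multiDiff_sum h α {()} (fun _ => c) (fun _ => g) k

theorem multiDiff_add_fun (h : ℝ) (α : Fin n → ℕ) (f g : HLattice n → ℂ) (k : HLattice n) :
    multiDiff h α (fun k' => f k' + g k') k = multiDiff h α f k + multiDiff h α g k := by
  simp only [multiDiff_eq_shiftAction]
  exact congrFun (map_add _ f g) k

theorem multiDiff_sub_fun (h : ℝ) (α : Fin n → ℕ) (f g : HLattice n → ℂ) (k : HLattice n) :
    multiDiff h α (fun k' => f k' - g k') k = multiDiff h α f k - multiDiff h α g k := by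
  simp only [multiDiff_eq_shiftAction]
  exact congrFun (map_sub _ f g) k

theorem isSmoothOnTorus_multiDiff {G : HLattice n → Torus n → ℂ}
    (hG : ∀ k, IsSmoothOnTorus (G k)) (h : ℝ) (α : Fin n → ℕ) (k : HLattice n) :
    IsSmoothOnTorus fun θ => multiDiff h α (fun k' => G k' θ) k := by
  obtain ⟨s, c, hc⟩ := exists_multiDiff_eq_sum h α
  simp only [hc]
  exact IsSmoothOnTorus.sum fun v _ => (hG _).const_mul _

theorem multiD_multiDiff {G : HLattice n → Torus n → ℂ} (hG : ∀ k, IsSmoothOnTorus (G k))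
    (h : ℝ) (α β : Fin n → ℕ) (k : HLattice n) (θ : Torus n) :
    multiD h β (fun θ' => multiDiff h α (fun k' => G k' θ') k) θ
      = multiDiff h α (fun k' => multiD h β (G k') θ) k := by
  obtain ⟨s, c, hc⟩ := exists_multiDiff_eq_sum h α
  simp only [hc]
  rw [multiD_sum c fun v _ => hG _]

theorem mFourierCoeff_multiDiff {G : HLattice n → Torus n → ℂ} (hG : ∀ k, IsSmoothOnTorus (G k))
    (h : ℝ) (α : Fin n → ℕ) (k j : HLattice n) :
    UnitAddTorus.mFourierCoeff (fun θ' => multiDiff h α (fun k' => G k' θ') k) j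
      = multiDiff h α (fun k' => UnitAddTorus.mFourierCoeff (G k') j) k := by
  obtain ⟨s, c, hc⟩ := exists_multiDiff_eq_sum h α
  simp only [hc]
  rw [mFourierCoeff_sum c fun v _ => hG _]

/-! ### Weighted bounds and symbol classes -/

/-- `F (k, θ) = O(weight k ^ s)`, uniformly in `θ`. -/
def WeightBound (s : ℝ) (F : HLattice n → Torus n → ℂ) : Prop :=
  ∃ C : ℝ, 0 ≤ C ∧ ∀ k θ, ‖F k θ‖ ≤ C * weight k ^ s

namespace WeightBound

variable {s t : ℝ} {F G : HLattice n → Torus n → ℂ}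

theorem mono (hst : s ≤ t) (hF : WeightBound s F) : WeightBound t F := by
  obtain ⟨C, hC, hb⟩ := hF
  exact ⟨C, hC, fun k θ => (hb k θ).trans
    (mul_le_mul_of_nonneg_left (weight_rpow_le_rpow k hst) hC)⟩

theorem const_mul (c : ℂ) (hF : WeightBound s F) : WeightBound s fun k θ => c * F k θ := by
  obtain ⟨C, hC, hb⟩ := hF
  refine ⟨‖c‖ * C, by positivity, fun k θ => ?_⟩
  rw [norm_mul, mul_assoc]
  exact mul_le_mul_of_nonneg_left (hb k θ) (norm_nonneg c)

theorem add (hF : WeightBound s F) (hG : WeightBound s G) :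
    WeightBound s fun k θ => F k θ + G k θ := by
  obtain ⟨C, hC, hb⟩ := hF
  obtain ⟨D, hD, hd⟩ := hG
  refine ⟨C + D, by positivity, fun k θ => (norm_add_le _ _).trans ?_⟩
  rw [add_mul]
  exact add_le_add (hb k θ) (hd k θ)

theorem sum {ι : Type*} {S : Finset ι} {F : ι → HLattice n → Torus n → ℂ}
    (hF : ∀ v ∈ S, WeightBound s (F v)) : WeightBound s fun k θ => ∑ v ∈ S, F v k θ := by
  classical
  induction S using Finset.induction_on with
  | empty => exact ⟨0, le_rfl, fun k θ => by simp⟩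
  | insert v S hv ih =>
    simp only [Finset.sum_insert hv]
    exact (hF v (by simp)).add (ih fun w hw => hF w (by simp [hw]))

theorem shift (v : HLattice n) (hF : WeightBound s F) : WeightBound s fun k θ => F (k + v) θ := by
  obtain ⟨C, hC, hb⟩ := hF
  refine ⟨C * weight v ^ |s|, mul_nonneg hC (weight_rpow_pos v _).le, fun k θ => ?_⟩
  rw [mul_assoc]
  exact (hb _ θ).trans (mul_le_mul_of_nonneg_left (weight_add_rpow_le k v s) hC)

/-- No gain of order is claimed. This is enough for errors whose order is arbitrarily negative. -/
theorem multiDiff (h : ℝ) (α : Fin n → ℕ) (hF : WeightBound s F) :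
    WeightBound s fun k θ => SemiclassicalLattice.multiDiff h α (fun k' => F k' θ) k := by
  obtain ⟨S, c, hc⟩ := exists_multiDiff_eq_sum h α
  simp only [hc]
  exact sum fun v _ => (hF.shift v).const_mul (c v)

end WeightBound

theorem mem_symbolClass_iff {h : ℝ} (hpos : 0 < h) {ρ δ μ : ℝ} {F : HLattice n → Torus n → ℂ} :
    F ∈ SymbolClass n h ρ δ μ ↔ (∀ k, IsSmoothOnTorus (F k)) ∧ ∀ α β : Fin n → ℕ,
      WeightBound (μ - ρ * order α + δ * order β)
        fun k θ => multiDiff h α (fun k' => multiD h β (F k') θ) k := by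
  refine and_congr_right fun hF => forall_congr' fun α => forall_congr' fun β => ?_
  simp only [multiD_multiDiff hF]
  constructor
  · rintro ⟨C, hC, hb⟩
    obtain ⟨D, hD, hd⟩ := exists_latticeNorm_rpow_le (n := n) hpos (μ - ρ * order α + δ * order β)
    refine ⟨C * D, by positivity, fun k θ => (hb k θ).trans ?_⟩
    rw [mul_assoc]
    exact mul_le_mul_of_nonneg_left (hd k) hC.le
  · rintro ⟨C, hC, hb⟩
    obtain ⟨D, hD, hd⟩ := exists_weight_rpow_le (n := n) hpos (μ - ρ * order α + δ * order β)
    -- The symbol class asks for a positive constant, `WeightBound` only for a nonnegative one.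
    refine ⟨(C + 1) * D, by positivity, fun k θ => (hb k θ).trans ?_⟩
    rw [mul_assoc]
    exact mul_le_mul (by linarith) (hd k) (weight_rpow_pos k _).le (by linarith)

theorem amplitude_bound {h : ℝ} (hpos : 0 < h) {ρ δ μ₁ μ₂ : ℝ}
    {a : HLattice n → HLattice n → Torus n → ℂ} (ha : a ∈ AmplitudeClass n h ρ δ μ₁ μ₂)
    (α β γ : Fin n → ℕ) : ∃ C : ℝ, 0 ≤ C ∧ ∃ Q : ℕ, Q ≤ order γ ∧ ∀ k m θ,
      ‖multiDiff h α (fun k' => multiDiff h β (fun m' => multiD h γ (a k' m') θ) m) k‖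
        ≤ C * (weight k ^ (μ₁ - ρ * order α + δ * Q)
          * weight m ^ (μ₂ - ρ * order β + δ * ((order γ : ℝ) - Q))) := by
  obtain ⟨C, hC, Q, hQ, hb⟩ := ha.2 α β γ
  obtain ⟨D, hD, hd⟩ := exists_latticeNorm_rpow_le (n := n) hpos (μ₁ - ρ * order α + δ * Q)
  obtain ⟨E, hE, he⟩ := exists_latticeNorm_rpow_le (n := n) hpos
    (μ₂ - ρ * order β + δ * ((order γ : ℝ) - Q))
  refine ⟨C * (D * E), by positivity, Q, hQ, fun k m θ => ?_⟩
  have hcomm : multiDiff h α (fun k' => multiDiff h β (fun m' => multiD h γ (a k' m') θ) m) k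
      = multiD h γ (fun θ' =>
          multiDiff h α (fun k' => multiDiff h β (fun m' => a k' m' θ') m) k) θ := by
    rw [multiD_multiDiff (G := fun k' θ' => multiDiff h β (fun m' => a k' m' θ') m)
      fun k' => isSmoothOnTorus_multiDiff (ha.1 k') h β m]
    simp only [multiD_multiDiff (ha.1 _)]
  rw [hcomm]
  refine (hb k m θ).trans ?_
  have h0 : ∀ (k : HLattice n) (s : ℝ), 0 ≤ (1 + latticeNorm h k) ^ s := fun k s =>
    Real.rpow_nonneg (by have := latticeNorm_nonneg h k; linarith) s
  calc _ = C * ((1 + latticeNorm h k) ^ (μ₁ - ρ * order α + δ * Q)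
        * (1 + latticeNorm h m) ^ (μ₂ - ρ * order β + δ * ((order γ : ℝ) - Q))) := by ring
    _ ≤ C * ((D * weight k ^ (μ₁ - ρ * order α + δ * Q))
        * (E * weight m ^ (μ₂ - ρ * order β + δ * ((order γ : ℝ) - Q)))) :=
      mul_le_mul_of_nonneg_left (mul_le_mul (hd k) (he m) (h0 m _)
        (mul_nonneg hD.le (weight_rpow_pos k _).le)) hC.le
    _ = _ := by ring

/-! ### Restriction to the diagonal and the terms of the expansion -/

/-- Bounds for all mixed differences of `b (k, l, θ)` along the translates of the diagonal. -/
def DiagonalBound (h ρ s : ℝ) (b : HLattice n → HLattice n → Torus n → ℂ) : Prop :=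
  ∀ (α β : Fin n → ℕ) (v : HLattice n), WeightBound (s - ρ * (order α + order β))
    fun k θ => multiDiff h α (fun k' => multiDiff h β (fun l' => b k' l' θ) (k + v)) k

namespace DiagonalBound

variable {h ρ s t : ℝ} {b b' : HLattice n → HLattice n → Torus n → ℂ}

theorem mono (hst : s ≤ t) (hb : DiagonalBound h ρ s b) : DiagonalBound h ρ t b :=
  fun α β v => (hb α β v).mono (by linarith)

theorem const_mul (c : ℂ) (hb : DiagonalBound h ρ s b) :
    DiagonalBound h ρ s fun k l θ => c * b k l θ := fun α β v => by
  simpa only [multiDiff_const_mul] using (hb α β v).const_mul c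

theorem add (hb : DiagonalBound h ρ s b) (hb' : DiagonalBound h ρ s b') :
    DiagonalBound h ρ s fun k l θ => b k l θ + b' k l θ := fun α β v => by
  simpa only [multiDiff_add_fun] using (hb α β v).add (hb' α β v)

theorem multiDiff_right (hb : DiagonalBound h ρ s b) (γ : Fin n → ℕ) :
    DiagonalBound h ρ (s - ρ * order γ)
      fun k l θ => multiDiff h γ (fun l' => b k l' θ) l := fun α β v => by
  have := hb α (β + γ) v
  simp only [multiDiff_add] at this
  refine this.mono ?_
  rw [order_add]
  push_cast
  linarith

/-- The shift `w` is produced by the discrete Leibniz rule; it is why `DiagonalBound` ranges over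
all translates `v` of the diagonal. -/
theorem multiDiff_left (hb : DiagonalBound h ρ s b) (γ : Fin n → ℕ) (w : HLattice n) :
    DiagonalBound h ρ (s - ρ * order γ)
      fun k l θ => multiDiff h γ (fun k' => b k' (l + w) θ) k := fun α β v => by
  have := hb (α + γ) β (v + w)
  simp only [multiDiff_add] at this
  have e : ∀ (k : HLattice n) (θ : Torus n),
      multiDiff h α (fun k' => multiDiff h β
        (fun l' => multiDiff h γ (fun k'' => b k'' (l' + w) θ) k') (k + v)) k
      = multiDiff h α (multiDiff h γ
          fun k' => multiDiff h β (fun l' => b k' l' θ) (k + (v + w))) k := fun k θ => by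
    congr 1
    ext k'
    rw [← multiDiff_comm h γ β fun k' l' => b k' (l' + w) θ]
    congr 1
    ext k''
    rw [multiDiff_shift h β (fun l' => b k'' l' θ), add_assoc]
  simp only [e]
  refine this.mono ?_
  rw [order_add]
  push_cast
  linarith

/-- Discrete Leibniz rule: a difference of `k ↦ b(k,k)` in direction `i` is the difference in the
first variable, with the second moved by the unit vector, plus the difference in the second. Either
one lowers the order by `ρ`. -/
theorem multiDiff_diagonal (α : Fin n → ℕ) {b : HLattice n → HLattice n → Torus n → ℂ} {s : ℝ}
    (hb : DiagonalBound h ρ s b) :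
    WeightBound (s - ρ * order α) fun k θ => multiDiff h α (fun k' => b k' k' θ) k := by
  induction α using multiIndex_induction generalizing b s with
  | zero => simpa [multiDiff_zero, order_zero] using hb 0 0 0
  | add_single α i ih =>
    have h1 := ih (hb.multiDiff_left (Pi.single i 1) (Pi.single i 1))
    have h2 := ih (hb.multiDiff_right (Pi.single i 1))
    have h3 := h1.add h2
    simp only [← multiDiff_add_fun, multiDiff_single] at h3
    have e : ∀ θ : Torus n, (fun k' => latticeDiff h i (fun k'' => b k'' (k' + Pi.single i 1) θ) k'
        + latticeDiff h i (fun l' => b k' l' θ) k') = latticeDiff h i fun k' => b k' k' θ := by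
      intro θ
      ext k'
      simp only [latticeDiff]
      ring
    simp only [e] at h3
    simp only [multiDiff_add, multiDiff_single]
    refine h3.mono ?_
    rw [order_add]
    push_cast
    linarith

end DiagonalBound

variable {h ρ δ μ₁ μ₂ : ℝ} {a : HLattice n → HLattice n → Torus n → ℂ}

/-- The composite of `D^{(β)}` and `D^{(γ)}` is not `D^{(β+γ)}`. The composition rule moves one
factor at a time from `β` to `γ`, and its correction has lower order because `0 ≤ δ`. At `β = 0` the
weights of `k` and `k + v` are comparable, so the split `Q` of the loss disappears. -/
theorem diagonalBound_multiD_multiD (hpos : 0 < h) (hδ : 0 ≤ δ)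
    (ha : a ∈ AmplitudeClass n h ρ δ μ₁ μ₂) (β γ : Fin n → ℕ) :
    DiagonalBound h ρ (μ₁ + μ₂ + δ * (order β + order γ))
      fun k l θ => multiD h β (multiD h γ (a k l)) θ := by
  induction β using multiIndex_induction generalizing γ with
  | zero =>
    simp only [multiD_zero (isSmoothOnTorus_multiD (ha.1 _ _) h γ)]
    intro α β v
    obtain ⟨C, hC, Q, -, hb⟩ := amplitude_bound hpos ha α β γ
    set t := μ₂ - ρ * order β + δ * ((order γ : ℝ) - Q)
    refine ⟨C * weight v ^ |t|, mul_nonneg hC (weight_rpow_pos v _).le, fun k θ => ?_⟩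
    refine (hb k (k + v) θ).trans ?_
    have e : μ₁ + μ₂ + δ * ((order (0 : Fin n → ℕ) : ℝ) + order γ) - ρ * (order α + order β)
        = (μ₁ - ρ * order α + δ * Q) + t := by
      simp only [t, order_zero]
      push_cast
      ring
    rw [e, Real.rpow_add (weight_pos k) _ t, mul_assoc C]
    refine mul_le_mul_of_nonneg_left ?_ hC
    calc _ ≤ weight k ^ (μ₁ - ρ * order α + δ * Q) * (weight v ^ |t| * weight k ^ t) :=
          mul_le_mul_of_nonneg_left (weight_add_rpow_le k v t) (weight_rpow_pos k _).le
      _ = _ := by ring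
  | add_single β i ih =>
    simp only [multiD_add_single_multiD (ha.1 _ _), sub_eq_add_neg, ← neg_mul]
    refine DiagonalBound.add ((ih _).mono (le_of_eq ?_)) (((ih _).const_mul _).mono ?_)
    · rw [order_add, order_add]
      push_cast
      ring
    · rw [order_add, order_single]
      push_cast
      nlinarith

theorem isSmoothOnTorus_expansionTerm (ha : ∀ k l, IsSmoothOnTorus (a k l)) (α : Fin n → ℕ)
    (k : HLattice n) : IsSmoothOnTorus (expansionTerm h a α k) :=
  (isSmoothOnTorus_multiDiff (G := fun l => multiD h α (a k l))
    (fun l => isSmoothOnTorus_multiD (ha k l) h α) h α k).const_mul _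

theorem expansionTerm_mem_symbolClass (hpos : 0 < h) (hδ : 0 ≤ δ)
    (ha : a ∈ AmplitudeClass n h ρ δ μ₁ μ₂) (α : Fin n → ℕ) :
    expansionTerm h a α ∈ SymbolClass n h ρ δ (μ₁ + μ₂ - order α * (ρ - δ)) := by
  refine (mem_symbolClass_iff hpos).2 ⟨isSmoothOnTorus_expansionTerm ha.1 α, fun α' β => ?_⟩
  have hsm : ∀ k l, IsSmoothOnTorus (multiD h α (a k l)) :=
    fun k l => isSmoothOnTorus_multiD (ha.1 k l) h α
  have hD : ∀ k θ, multiD h β (expansionTerm h a α k) θ = (1 / (multiFactorial α : ℂ))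
      * multiDiff h α (fun l => multiD h β (multiD h α (a k l)) θ) k := fun k θ => by
    rw [← multiD_multiDiff (hsm k)]
    have := multiD_sum (s := {()})
      (F := fun _ θ => multiDiff h α (fun l => multiD h α (a k l) θ) k)
      (fun _ => 1 / (multiFactorial α : ℂ))
      (fun _ _ => isSmoothOnTorus_multiDiff (hsm k) h α k) h β
    simp only [Finset.sum_singleton] at this
    exact congrFun this θ
  simp only [hD]
  refine ((((diagonalBound_multiD_multiD hpos hδ ha β α).multiDiff_right α).const_mul
    (1 / (multiFactorial α : ℂ))).multiDiff_diagonal α').mono (le_of_eq ?_)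
  ring

theorem symbolClass_mono (hpos : 0 < h) {s t : ℝ} (hst : s ≤ t) :
    SymbolClass n h ρ δ s ⊆ SymbolClass n h ρ δ t := fun F hF => by
  rw [mem_symbolClass_iff hpos] at hF ⊢
  exact ⟨hF.1, fun α β => (hF.2 α β).mono (by linarith)⟩

theorem sum_mem_symbolClass (hpos : 0 < h) {s : ℝ} {ι : Type*} {S : Finset ι}
    {F : ι → HLattice n → Torus n → ℂ} (hF : ∀ v ∈ S, F v ∈ SymbolClass n h ρ δ s) :
    (fun k θ => ∑ v ∈ S, F v k θ) ∈ SymbolClass n h ρ δ s := by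
  simp only [mem_symbolClass_iff hpos] at hF ⊢
  refine ⟨fun k => IsSmoothOnTorus.sum fun v hv => (hF v hv).1 k, fun α β => ?_⟩
  have hD : ∀ k θ, multiD h β (fun θ => ∑ v ∈ S, F v k θ) θ
      = ∑ v ∈ S, (1 : ℂ) * multiD h β (F v k) θ := fun k θ => by
    have := multiD_sum (s := S) (F := fun v => F v k) (fun _ => 1) (fun v hv => (hF v hv).1 k) h β
    simp only [one_mul] at this ⊢
    exact congrFun this θ
  have hΔ : ∀ k θ, multiDiff h α (fun k' => ∑ v ∈ S, (1 : ℂ) * multiD h β (F v k') θ) k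
      = ∑ v ∈ S, multiDiff h α (fun k' => multiD h β (F v k') θ) k := fun k θ => by
    simpa only [one_mul] using
      multiDiff_sum h α S (fun _ => 1) (fun v k' => multiD h β (F v k') θ) k
  simp only [hD, hΔ]
  exact WeightBound.sum fun v hv => (hF v hv).2 α β

/-- A smooth function that is approximated by symbols up to derivatives of arbitrarily small order
is a symbol. -/
theorem mem_symbolClass_of_approx (hpos : 0 < h) {s : ℝ} {F : HLattice n → Torus n → ℂ}
    (hF : ∀ k, IsSmoothOnTorus (F k))
    (happrox : ∀ (β : Fin n → ℕ) (K : ℝ), ∃ G ∈ SymbolClass n h ρ δ s,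
      WeightBound (-K) fun k θ => multiD h β (fun θ => F k θ - G k θ) θ) :
    F ∈ SymbolClass n h ρ δ s := by
  refine (mem_symbolClass_iff hpos).2 ⟨hF, fun α β => ?_⟩
  obtain ⟨G, hG, hFG⟩ := happrox β (-(s - ρ * order α + δ * order β))
  rw [mem_symbolClass_iff hpos] at hG
  rw [neg_neg] at hFG
  have := (hFG.multiDiff h α).add (hG.2 α β)
  simp only [multiD_sub (hF _) (hG.1 _), multiDiff_sub_fun, sub_add_cancel] at this
  exact this

/-! ### Fourier coefficients of the amplitude -/

open UnitAddTorus (mFourierCoeff)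

/-- The split `Q` given by the amplitude class is not known, so `X` is asked to dominate all splits;
only `q = 0` and `q = L` derivatives occur. -/
theorem weight_pow_mul_coeff_le (hpos : 0 < h) (ha : a ∈ AmplitudeClass n h ρ δ μ₁ μ₂)
    (α : Fin n → ℕ) (L : ℕ) : ∃ C : ℝ, 0 ≤ C ∧ ∀ (k l : HLattice n) (X : ℝ),
      (∀ q Q : ℕ, Q ≤ q → q ≤ L →
        weight k ^ (μ₁ + δ * Q) * weight l ^ (μ₂ - ρ * order α + δ * ((q : ℝ) - Q)) ≤ X) →
      ∀ j : HLattice n, weight j ^ (L : ℝ)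
        * ‖multiDiff h α (fun l' => mFourierCoeff (a k l') j) l‖ ≤ C * X := by
  obtain ⟨D, hD, hd⟩ := weight_pow_mul_mFourierCoeff_le hpos n L
  obtain ⟨C, hC, Q, hQ, hb⟩ := amplitude_bound hpos ha 0 α 0
  choose C' hC' Q' hQ' hb' using fun i => amplitude_bound hpos ha 0 α (Pi.single i L)
  simp only [multiDiff_zero, order_zero, Nat.cast_zero, mul_zero, sub_zero] at hb hb'
  have hsum : 0 ≤ ∑ i, C' i := Finset.sum_nonneg fun i _ => hC' i
  refine ⟨D * (C + ∑ i, C' i), mul_nonneg hD (add_nonneg hC hsum), fun k l X hX j => ?_⟩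
  have hX0 : 0 ≤ X := (mul_nonneg (weight_rpow_pos k _).le (weight_rpow_pos l _).le).trans
    (hX 0 0 le_rfl (Nat.zero_le L))
  rw [← mFourierCoeff_multiDiff (ha.1 k), mul_assoc]
  refine hd _ (isSmoothOnTorus_multiDiff (ha.1 k) h α l) _ (fun θ => ?_) (fun i θ => ?_) j
  · have := hb k l θ
    simp only [multiD_zero (ha.1 _ _)] at this
    refine this.trans ?_
    have hQ0 : Q = 0 := by rw [order_zero] at hQ; omega
    subst hQ0
    have h1 := hX 0 0 le_rfl (Nat.zero_le L)
    simp only [Nat.cast_zero, sub_zero] at h1 ⊢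
    rw [add_mul]
    exact (mul_le_mul_of_nonneg_left h1 hC).trans
      (le_add_of_nonneg_right (mul_nonneg hsum hX0))
  · rw [multiD_multiDiff (ha.1 k)]
    refine (hb' i k l θ).trans ?_
    have hi := hQ' i
    rw [order_single] at hi ⊢
    calc _ ≤ C' i * X := mul_le_mul_of_nonneg_left (hX L (Q' i) hi le_rfl) (hC' i)
      _ ≤ (C + ∑ i, C' i) * X := by
        refine mul_le_mul_of_nonneg_right ?_ hX0
        have := Finset.single_le_sum (fun i _ => hC' i) (Finset.mem_univ i)
        linarith

/-- Bound for the Fourier coefficients at positions of comparable size. -/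
theorem coeff_le_of_comparable (hpos : 0 < h) (hδ : 0 ≤ δ)
    (ha : a ∈ AmplitudeClass n h ρ δ μ₁ μ₂) (α : Fin n → ℕ) (L : ℕ) :
    ∃ C : ℝ, 0 ≤ C ∧ ∀ k l j : HLattice n, weight l ≤ 2 * weight k → weight k ≤ 2 * weight l →
      ‖multiDiff h α (fun l' => mFourierCoeff (a k l') j) l‖
        ≤ C * (weight k ^ (μ₁ + μ₂ - ρ * order α + δ * L) * weight j ^ (-(L : ℝ))) := by
  obtain ⟨C, hC, hb⟩ := weight_pow_mul_coeff_le hpos ha α L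
  -- `T` bounds the exponent of `weight l` for every split, so `weight l` is traded for `weight k`
  -- at the cost of `2 ^ T`.
  set T := |μ₂ - ρ * order α| + δ * L
  refine ⟨C * 2 ^ T, by positivity, fun k l j hlk hkl => ?_⟩
  have key := hb k l (2 ^ T * weight k ^ (μ₁ + μ₂ - ρ * order α + δ * L)) (fun q Q hQ hq => ?_) j
  · rw [Real.rpow_neg (weight_pos j).le, ← mul_assoc, ← div_eq_mul_inv,
      le_div_iff₀ (weight_rpow_pos j _), mul_comm, mul_assoc]
    exact key
  · set t := μ₂ - ρ * order α + δ * ((q : ℝ) - Q)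
    have hqQ : (0 : ℝ) ≤ (q : ℝ) - Q := sub_nonneg.2 (by exact_mod_cast hQ)
    have hqL : (q : ℝ) ≤ L := by exact_mod_cast hq
    have hQ0 : (0 : ℝ) ≤ Q := Q.cast_nonneg
    have ht : |t| ≤ T := by
      refine (abs_add_le _ _).trans (add_le_add le_rfl ?_)
      rw [abs_of_nonneg (mul_nonneg hδ hqQ)]
      exact mul_le_mul_of_nonneg_left (by linarith) hδ
    calc weight k ^ (μ₁ + δ * Q) * weight l ^ t
        ≤ weight k ^ (μ₁ + δ * Q) * (2 ^ |t| * weight k ^ t) :=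
          mul_le_mul_of_nonneg_left (rpow_le_rpow_abs_mul (weight_pos l) (weight_pos k)
            one_le_two hlk hkl t) (weight_rpow_pos k _).le
      _ = 2 ^ |t| * weight k ^ (μ₁ + δ * Q + t) := by
          rw [Real.rpow_add (weight_pos k) _ t]; ring
      _ ≤ _ := mul_le_mul (Real.rpow_le_rpow_of_exponent_le one_le_two ht)
          (weight_rpow_le_rpow k (by
            have := mul_le_mul_of_nonneg_left hqL hδ
            simp only [t]
            linarith)) (weight_rpow_pos k _).le (by positivity)

theorem weight_rpow_le_of_le {k : HLattice n} {y s t : ℝ} (hy : weight k ≤ y) (hst : |s| ≤ t) :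
    weight k ^ s ≤ y ^ t :=
  (weight_rpow_le_rpow k ((le_abs_self s).trans hst)).trans
    (Real.rpow_le_rpow (weight_pos k).le hy ((abs_nonneg s).trans hst))

/-- Rapid decay of the Fourier coefficients at frequencies that dominate the positions. -/
theorem coeff_le_of_dominated (hpos : 0 < h) (hδ : 0 ≤ δ) (hδ1 : δ < 1)
    (ha : a ∈ AmplitudeClass n h ρ δ μ₁ μ₂) (α : Fin n → ℕ) {R : ℝ} (hR : 1 ≤ R) (p : ℝ) :
    ∃ C : ℝ, 0 ≤ C ∧ ∀ k l j : HLattice n, weight k ≤ R * weight j → weight l ≤ R * weight j →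
      ‖multiDiff h α (fun l' => mFourierCoeff (a k l') j) l‖ ≤ C * weight j ^ (-p) := by
  set T := |μ₁| + |μ₂ - ρ * order α|
  -- `L` derivatives gain `L` powers of `weight j` and cost at most `T + δL`; this choice gives `T +
  -- δL - L ≤ -p`.
  obtain ⟨L, hL⟩ := exists_nat_ge ((T + p) / (1 - δ))
  rw [div_le_iff₀ (by linarith)] at hL
  obtain ⟨C, hC, hb⟩ := weight_pow_mul_coeff_le hpos ha α L
  refine ⟨C * R ^ (T + δ * L), by positivity, fun k l j hk hl => ?_⟩
  have hRj : 1 ≤ R * weight j := one_le_mul_of_one_le_of_one_le hR (one_le_weight j)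
  have key := hb k l ((R * weight j) ^ (T + δ * L)) (fun q Q hQ hq => ?_) j
  · rw [mul_comm, ← le_div_iff₀ (weight_rpow_pos j _)] at key
    refine key.trans ?_
    rw [Real.mul_rpow (by linarith) (weight_pos j).le, mul_div_assoc, mul_div_assoc,
      ← Real.rpow_sub (weight_pos j), mul_assoc]
    refine mul_le_mul_of_nonneg_left (mul_le_mul_of_nonneg_left
      (weight_rpow_le_rpow j (by linarith)) (by positivity)) hC
  · have hqQ : (0 : ℝ) ≤ (q : ℝ) - Q := sub_nonneg.2 (by exact_mod_cast hQ)
    have hqL : (q : ℝ) ≤ L := by exact_mod_cast hq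
    have hδQ : 0 ≤ δ * Q := mul_nonneg hδ Q.cast_nonneg
    have h1 : |μ₁ + δ * Q| ≤ |μ₁| + δ * Q :=
      (abs_add_le _ _).trans_eq (by rw [abs_of_nonneg hδQ])
    have h2 : |μ₂ - ρ * order α + δ * ((q : ℝ) - Q)| ≤ |μ₂ - ρ * order α| + δ * ((q : ℝ) - Q) :=
      (abs_add_le _ _).trans_eq (by rw [abs_of_nonneg (mul_nonneg hδ hqQ)])
    calc _ ≤ (R * weight j) ^ (|μ₁| + δ * Q)
          * (R * weight j) ^ (|μ₂ - ρ * order α| + δ * ((q : ℝ) - Q)) :=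
          mul_le_mul (weight_rpow_le_of_le hk h1) (weight_rpow_le_of_le hl h2)
            (weight_rpow_pos l _).le (by positivity)
      _ = (R * weight j) ^ (T + δ * q) := by
          rw [← Real.rpow_add (by linarith)]
          congr 1
          simp only [T]
          ring
      _ ≤ _ := Real.rpow_le_rpow_of_exponent_le hRj (by
          have := mul_le_mul_of_nonneg_left hqL hδ
          linarith)

theorem exists_uniform_bound {ι κ : Type*} (S : Finset ι) {u : ι → κ → ℝ} {v : κ → ℝ}
    {P : κ → Prop} (hv : ∀ x, 0 ≤ v x)
    (hu : ∀ i, ∃ C : ℝ, 0 ≤ C ∧ ∀ x, P x → u i x ≤ C * v x) :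
    ∃ C : ℝ, 0 ≤ C ∧ ∀ i ∈ S, ∀ x, P x → u i x ≤ C * v x := by
  choose C hC hb using hu
  exact ⟨∑ i ∈ S, C i, Finset.sum_nonneg fun i _ => hC i, fun i hi x hx => (hb i x hx).trans
    (mul_le_mul_of_nonneg_right (Finset.single_le_sum (fun i _ => hC i) hi) (hv x))⟩

/-! ### The remainder estimate -/

theorem newtonRemainder_coeff_le (hpos : 0 < h) (hδ : 0 ≤ δ) (hδ1 : δ < 1) (hδρ : δ < ρ)
    (ha : a ∈ AmplitudeClass n h ρ δ μ₁ μ₂) {K : ℝ} (hK : 0 ≤ K) (p : ℕ) :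
    ∃ M₀ : ℕ, ∀ M : ℕ, M₀ ≤ M → ∃ C : ℝ, 0 ≤ C ∧ ∀ k j : HLattice n,
      ‖newtonRemainder h M (fun l => mFourierCoeff (a k l) j) k j‖
        ≤ C * (weight k ^ (-K) * weight j ^ (-(p : ℝ))) := by
  -- From `M₀` on, the exponent `μ₁ + μ₂ - ρM + δ(M + p)` left by `M` differences and `M + p`
  -- derivatives is at most `-K`.
  obtain ⟨M₀, hM₀⟩ := exists_nat_ge ((μ₁ + μ₂ + δ * p + K) / (ρ - δ))
  rw [div_le_iff₀ (by linarith)] at hM₀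
  refine ⟨M₀, fun M hM => ?_⟩
  have hMK : μ₁ + μ₂ - ρ * M + δ * ((M + p : ℕ) : ℝ) ≤ -K := by
    have hMM : (M₀ : ℝ) ≤ M := by exact_mod_cast hM
    push_cast
    nlinarith
  -- The power `ρ|α|` stands on the left so that the right side is free of `α`, as a constant
  -- uniform in `α` requires. The bound `M + 1` is there to include `|α| = M`.
  obtain ⟨C₁, hC₁, hb₁⟩ : ∃ C : ℝ, 0 ≤ C ∧ ∀ α ∈ multiIndexLT n (M + 1),
      ∀ x : HLattice n × HLattice n × HLattice n,
      (weight x.2.1 ≤ 2 * weight x.1 ∧ weight x.1 ≤ 2 * weight x.2.1) →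
      weight x.1 ^ (ρ * order α) *
        ‖multiDiff h α (fun l' => mFourierCoeff (a x.1 l') x.2.2) x.2.1‖
      ≤ C * (weight x.1 ^ (μ₁ + μ₂ + δ * ((M + p : ℕ) : ℝ))
        * weight x.2.2 ^ (-((M + p : ℕ) : ℝ))) := by
    refine exists_uniform_bound _ (fun x => (mul_pos (weight_rpow_pos _ _)
      (weight_rpow_pos _ _)).le) fun α => ?_
    obtain ⟨C, hC, hb⟩ := coeff_le_of_comparable hpos hδ ha α (M + p)
    refine ⟨C, hC, fun x hx => (mul_le_mul_of_nonneg_left (hb x.1 x.2.1 x.2.2 hx.1 hx.2)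
      (weight_rpow_pos x.1 _).le).trans_eq ?_⟩
    rw [show μ₁ + μ₂ + δ * ((M + p : ℕ) : ℝ)
      = ρ * order α + (μ₁ + μ₂ - ρ * order α + δ * ((M + p : ℕ) : ℝ)) by ring,
      Real.rpow_add (weight_pos x.1) (ρ * order α)]
    ring
  obtain ⟨C₂, hC₂, hb₂⟩ : ∃ C : ℝ, 0 ≤ C ∧ ∀ α ∈ multiIndexLT n (M + 1),
      ∀ x : HLattice n × HLattice n × HLattice n,
      (weight x.1 ≤ 3 * weight x.2.2 ∧ weight x.2.1 ≤ 3 * weight x.2.2) →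
      ‖multiDiff h α (fun l' => mFourierCoeff (a x.1 l') x.2.2) x.2.1‖
      ≤ C * weight x.2.2 ^ (-(K + (M + p : ℕ))) := by
    refine exists_uniform_bound _ (fun x => (weight_rpow_pos _ _).le) fun α => ?_
    obtain ⟨C, hC, hb⟩ := coeff_le_of_dominated hpos hδ hδ1 ha α
      (R := 3) (by norm_num) (K + (M + p : ℕ))
    exact ⟨C, hC, fun x hx => hb x.1 x.2.1 x.2.2 hx.1 hx.2⟩
  refine ⟨(h * n) ^ M * (C₁ + C₂ * 3 ^ K), by positivity, fun k j => ?_⟩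
  have hw := weight_rpow_pos k (-K)
  have hwj := weight_rpow_pos j (-((M + p : ℕ) : ℝ))
  have h3K : (0 : ℝ) < 3 ^ K := by positivity
  have hbound : ∀ α : Fin n → ℕ, order α = M → ∀ t : HLattice n, ‖t‖ ≤ ‖j‖ →
      ‖multiDiff h α (fun l => mFourierCoeff (a k l) j) (k + t)‖
        ≤ (C₁ + C₂ * 3 ^ K) * (weight k ^ (-K) * weight j ^ (-((M + p : ℕ) : ℝ))) := by
    intro α hα t ht
    have hmem : α ∈ multiIndexLT n (M + 1) := (mem_multiIndexLT α).2 (by omega)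
    have htri := norm_add_le k t
    have htri' := norm_sub_le (k + t) t
    rw [add_sub_cancel_right] at htri'
    have hj0 := norm_nonneg j
    -- In the first case `k` and `k + t` have weights within a factor 2 of each other; in the second
    -- both weights are at most `3 * weight j`.
    rcases le_or_gt (2 * ‖j‖) ‖k‖ with hjk | hjk
    · have h1 := hb₁ α hmem (k, k + t, j) ⟨by simp only [weight]; linarith,
        by simp only [weight]; linarith⟩
      rw [hα] at h1
      dsimp only at h1
      rw [mul_comm, ← le_div_iff₀ (weight_rpow_pos k _)] at h1
      refine h1.trans ?_
      calc _ = C₁ * (weight k ^ (μ₁ + μ₂ - ρ * M + δ * ((M + p : ℕ) : ℝ))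
            * weight j ^ (-((M + p : ℕ) : ℝ))) := by
            rw [show μ₁ + μ₂ - ρ * M + δ * ((M + p : ℕ) : ℝ)
              = μ₁ + μ₂ + δ * ((M + p : ℕ) : ℝ) - ρ * M by ring, Real.rpow_sub (weight_pos k)]
            ring
        _ ≤ C₁ * (weight k ^ (-K) * weight j ^ (-((M + p : ℕ) : ℝ))) :=
            mul_le_mul_of_nonneg_left (mul_le_mul_of_nonneg_right
              (weight_rpow_le_rpow k hMK) hwj.le) hC₁
        _ ≤ _ := mul_le_mul_of_nonneg_right (by nlinarith) (mul_pos hw hwj).le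
    · have hk3 : weight k ≤ 3 * weight j := by simp only [weight]; linarith
      have h2 := hb₂ α hmem (k, k + t, j) ⟨hk3, by simp only [weight]; linarith⟩
      refine h2.trans ?_
      have hK3 : weight j ^ (-K) ≤ 3 ^ K * weight k ^ (-K) := by
        rw [Real.rpow_neg (weight_pos j).le, Real.rpow_neg (weight_pos k).le, ← div_eq_mul_inv,
          le_div_iff₀ (weight_rpow_pos k K), inv_mul_le_iff₀ (weight_rpow_pos j K), mul_comm,
          ← Real.mul_rpow (by norm_num) (weight_pos j).le]
        exact Real.rpow_le_rpow (weight_pos k).le hk3 hK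
      calc _ = C₂ * (weight j ^ (-K) * weight j ^ (-((M + p : ℕ) : ℝ))) := by
            rw [← Real.rpow_add (weight_pos j), neg_add]
        _ ≤ C₂ * (3 ^ K * weight k ^ (-K) * weight j ^ (-((M + p : ℕ) : ℝ))) :=
            mul_le_mul_of_nonneg_left (mul_le_mul_of_nonneg_right hK3 hwj.le) hC₂
        _ = C₂ * 3 ^ K * (weight k ^ (-K) * weight j ^ (-((M + p : ℕ) : ℝ))) := by ring
        _ ≤ _ := mul_le_mul_of_nonneg_right (by linarith) (mul_pos hw hwj).le
  refine (norm_newtonRemainder_le h hpos M _ k (by positivity) hbound j le_rfl).trans ?_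
  -- The growth `‖j‖^M` of the remainder uses up `M` of the `M + p` powers of decay.
  have hjw : (h * (n * ‖j‖)) ^ M ≤ (h * n) ^ M * weight j ^ (M : ℝ) := by
    rw [Real.rpow_natCast, ← mul_pow, ← mul_assoc]
    refine pow_le_pow_left₀ (by positivity) (mul_le_mul_of_nonneg_left ?_ (by positivity)) M
    simp [weight]
  calc _ ≤ (h * n) ^ M * weight j ^ (M : ℝ) * ((C₁ + C₂ * 3 ^ K)
        * (weight k ^ (-K) * weight j ^ (-((M + p : ℕ) : ℝ)))) :=
        mul_le_mul_of_nonneg_right hjw (by positivity)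
    _ = (h * n) ^ M * (C₁ + C₂ * 3 ^ K)
        * (weight k ^ (-K) * (weight j ^ (M : ℝ) * weight j ^ (-((M + p : ℕ) : ℝ)))) := by ring
    _ = _ := by
        rw [← Real.rpow_add (weight_pos j)]
        congr 4
        push_cast
        ring

/-! ### The symbol and its asymptotic expansion -/

/-- The symbol `σ (k, θ) = ∑ j, exp (2 π i j ⬝ θ) (a (k, k + j, ·))^ (j)` of the operator with
amplitude `a`. -/
def amplitudeSymbol (a : HLattice n → HLattice n → Torus n → ℂ) (k : HLattice n) (θ : Torus n) :
    ℂ :=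
  ∑' j, mFourierCoeff (a k (k + j)) j * latticeChar j θ

/-- For fixed `k` the constant may depend on `k`, so `R = weight k` makes every frequency dominate
both positions. -/
theorem summable_coeff_mul_weight (hpos : 0 < h) (hδ : 0 ≤ δ) (hδ1 : δ < 1)
    (ha : a ∈ AmplitudeClass n h ρ δ μ₁ μ₂) (k : HLattice n) (m : ℕ) :
    Summable fun j => ‖mFourierCoeff (a k (k + j)) j‖ * weight j ^ m := by
  obtain ⟨C, hC, hb⟩ := coeff_le_of_dominated hpos hδ hδ1 ha 0 (one_le_weight k)
    (2 * n + m : ℝ)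
  refine (summable_weight.mul_left C).of_nonneg_of_le
    (fun j => mul_nonneg (norm_nonneg _) (pow_pos (weight_pos j) m).le) fun j => ?_
  have := hb k (k + j) j (le_mul_of_one_le_right (weight_pos k).le (one_le_weight j))
    (weight_add_le k j)
  rw [multiDiff_zero] at this
  refine (mul_le_mul_of_nonneg_right this (pow_pos (weight_pos j) m).le).trans_eq ?_
  rw [mul_assoc, ← Real.rpow_natCast, ← Real.rpow_add (weight_pos j)]
  congr 2
  ring

theorem isSmoothOnTorus_amplitudeSymbol (hpos : 0 < h) (hδ : 0 ≤ δ) (hδ1 : δ < 1)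
    (ha : a ∈ AmplitudeClass n h ρ δ μ₁ μ₂) (k : HLattice n) :
    IsSmoothOnTorus (amplitudeSymbol a k) :=
  isSmoothOnTorus_tsum (summable_coeff_mul_weight hpos hδ hδ1 ha k)

theorem mFourierCoeff_amplitudeSymbol (hpos : 0 < h) (hδ : 0 ≤ δ) (hδ1 : δ < 1)
    (ha : a ∈ AmplitudeClass n h ρ δ μ₁ μ₂) (k j : HLattice n) :
    mFourierCoeff (amplitudeSymbol a k) j = mFourierCoeff (a k (k + j)) j :=
  mFourierCoeff_tsum (by simpa using summable_coeff_mul_weight hpos hδ hδ1 ha k 0) j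

theorem mFourierCoeff_expansionTerm (ha : ∀ k l, IsSmoothOnTorus (a k l)) (α : Fin n → ℕ)
    (k j : HLattice n) : mFourierCoeff (expansionTerm h a α k) j
      = multiplier h α j * ((1 / (multiFactorial α : ℂ))
        * multiDiff h α (fun l => mFourierCoeff (a k l) j) k) := by
  have hsm : ∀ l, IsSmoothOnTorus (multiD h α (a k l)) :=
    fun l => isSmoothOnTorus_multiD (ha k l) h α
  have h1 := mFourierCoeff_sum (s := {()})
    (F := fun _ θ => multiDiff h α (fun l => multiD h α (a k l) θ) k)
    (fun _ => 1 / (multiFactorial α : ℂ))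
    (fun _ _ => isSmoothOnTorus_multiDiff hsm h α k) j
  simp only [Finset.sum_singleton] at h1
  refine h1.trans ?_
  rw [mFourierCoeff_multiDiff hsm]
  simp only [mFourierCoeff_multiD (ha k _), multiDiff_const_mul]
  ring

theorem weightBound_amplitudeSymbol_sub (hpos : 0 < h) (hδ : 0 ≤ δ) (hδ1 : δ < 1) (hδρ : δ < ρ)
    (ha : a ∈ AmplitudeClass n h ρ δ μ₁ μ₂) (β : Fin n → ℕ) (K : ℝ) :
    ∃ M₀ : ℕ, ∀ M : ℕ, M₀ ≤ M → WeightBound (-K) fun k θ => multiD h β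
      (fun θ => amplitudeSymbol a k θ - ∑ α ∈ multiIndexLT n M, expansionTerm h a α k θ) θ := by
  obtain ⟨D, hD, hd⟩ := abs_multiplier_le (n := n) hpos β
  -- Of the decay in `j`, `order β` powers pay for the multiplier of `D^{(β)}` and `2n` for the sum
  -- over `j`. The estimate needs a nonnegative exponent, hence `|K|`.
  obtain ⟨M₀, hM₀⟩ := newtonRemainder_coeff_le hpos hδ hδ1 hδρ ha (abs_nonneg K)
    (order β + 2 * n)
  refine ⟨M₀, fun M hM => ?_⟩
  obtain ⟨C, hC, hb⟩ := hM₀ M hM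
  have hs : ∀ k, IsSmoothOnTorus (amplitudeSymbol a k) :=
    isSmoothOnTorus_amplitudeSymbol hpos hδ hδ1 ha
  have hE : ∀ k, ∀ α ∈ multiIndexLT n M, IsSmoothOnTorus (expansionTerm h a α k) :=
    fun k α _ => isSmoothOnTorus_expansionTerm ha.1 α k
  have hsE : ∀ k, IsSmoothOnTorus fun θ => ∑ α ∈ multiIndexLT n M, expansionTerm h a α k θ :=
    fun k => IsSmoothOnTorus.sum (hE k)
  have hcoeff : ∀ k j, mFourierCoeff (multiD h β fun θ =>
      amplitudeSymbol a k θ - ∑ α ∈ multiIndexLT n M, expansionTerm h a α k θ) j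
      = multiplier h β j * newtonRemainder h M (fun l => mFourierCoeff (a k l) j) k j := by
    intro k j
    have h1 := mFourierCoeff_const_mul_sub (hs k) (hsE k) 1 1 j
    have h2 := mFourierCoeff_sum (fun _ => 1) (hE k) j
    simp only [one_mul] at h1 h2
    rw [mFourierCoeff_multiD ((hs k).sub (hsE k)), h1, h2,
      mFourierCoeff_amplitudeSymbol hpos hδ hδ1 ha, newtonRemainder]
    simp only [mFourierCoeff_expansionTerm ha.1]
  have hle : ∀ k j, ‖mFourierCoeff (multiD h β fun θ =>
      amplitudeSymbol a k θ - ∑ α ∈ multiIndexLT n M, expansionTerm h a α k θ) j‖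
      ≤ D * C * weight k ^ (-|K|) * weight j ^ (-(2 * n : ℝ)) := by
    intro k j
    rw [hcoeff, norm_mul, Complex.norm_real, Real.norm_eq_abs]
    refine (mul_le_mul (hd j) (hb k j) (norm_nonneg _)
      (mul_nonneg hD (weight_rpow_pos j _).le)).trans_eq ?_
    rw [show -(2 * n : ℝ) = order β + (-((order β + 2 * n : ℕ) : ℝ)) by push_cast; ring,
      Real.rpow_add (weight_pos j)]
    ring
  refine WeightBound.mono (neg_le_neg (le_abs_self K))
    ⟨D * C * ∑' j : HLattice n, weight j ^ (-(2 * n : ℝ)),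
      mul_nonneg (mul_nonneg hD hC) (tsum_nonneg fun j => (weight_rpow_pos j _).le),
      fun k θ => ?_⟩
  have hsumm := summable_weight (n := n).mul_left (D * C * weight k ^ (-|K|))
  have hsumm' := hsumm.of_nonneg_of_le (fun _ => norm_nonneg _) (hle k)
  refine (norm_le_tsum_mFourierCoeff (isSmoothOnTorus_multiD ((hs k).sub (hsE k)) h β)
    hsumm' θ).trans ((hsumm'.tsum_le_tsum (hle k) hsumm).trans_eq ?_)
  rw [tsum_mul_left]
  ring

theorem amplitudeSymbol_sub_mem_symbolClass (hpos : 0 < h) (hδ : 0 ≤ δ) (hδ1 : δ < 1)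
    (hδρ : δ < ρ) (ha : a ∈ AmplitudeClass n h ρ δ μ₁ μ₂) (N : ℕ) :
    (fun k θ => amplitudeSymbol a k θ - ∑ α ∈ multiIndexLT n N, expansionTerm h a α k θ)
      ∈ SymbolClass n h ρ δ (μ₁ + μ₂ - N * (ρ - δ)) := by
  refine mem_symbolClass_of_approx hpos (fun k =>
    (isSmoothOnTorus_amplitudeSymbol hpos hδ hδ1 ha k).sub
      (IsSmoothOnTorus.sum fun α _ => isSmoothOnTorus_expansionTerm ha.1 α k)) fun β K => ?_
  obtain ⟨M₀, hM₀⟩ := weightBound_amplitudeSymbol_sub hpos hδ hδ1 hδρ ha β K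
  have hsub : multiIndexLT n N ⊆ multiIndexLT n (max M₀ N) := fun α hα => by
    rw [mem_multiIndexLT] at hα ⊢
    exact hα.trans_le (le_max_right _ _)
  -- The approximating symbol consists of the terms with `N ≤ |α| < max M₀ N`, each of order at most
  -- that of `|α| = N`.
  refine ⟨fun k θ => ∑ α ∈ multiIndexLT n (max M₀ N) \ multiIndexLT n N,
    expansionTerm h a α k θ, sum_mem_symbolClass hpos fun α hα => ?_, ?_⟩
  · refine symbolClass_mono hpos ?_ (expansionTerm_mem_symbolClass hpos hδ ha α)
    rw [Finset.mem_sdiff, mem_multiIndexLT, mem_multiIndexLT, not_lt] at hα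
    have : (N : ℝ) ≤ order α := by exact_mod_cast hα.2
    nlinarith
  · have := hM₀ _ (le_max_left M₀ N)
    simp only [← Finset.sum_sdiff hsub] at this
    simpa only [sub_sub, add_comm] using this

/-! ### Operators on rapidly decreasing functions -/

theorem SchwartzLattice.exists_norm_le (hpos : 0 < h) {f : HLattice n → ℂ}
    (hf : f ∈ SchwartzLattice n h) (s : ℝ) :
    ∃ C : ℝ, 0 ≤ C ∧ ∀ k, ‖f k‖ ≤ C * weight k ^ s := by
  obtain ⟨N, hN⟩ := exists_nat_ge (-s)
  obtain ⟨C, hC⟩ := hf N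
  obtain ⟨D, hD, hd⟩ := exists_latticeNorm_rpow_le (n := n) hpos (-(N : ℝ))
  refine ⟨|C| * D, by positivity, fun k => (hC k).trans ?_⟩
  have h0 : 0 ≤ (1 + latticeNorm h k) ^ (-(N : ℝ)) :=
    Real.rpow_nonneg (by have := latticeNorm_nonneg h k; linarith) _
  rw [mul_assoc]
  exact mul_le_mul (le_abs_self C) ((hd k).trans (mul_le_mul_of_nonneg_left
    (weight_rpow_le_rpow k (by linarith)) hD.le)) h0 (abs_nonneg C)

theorem SchwartzLattice.summable_norm (hpos : 0 < h) {f : HLattice n → ℂ}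
    (hf : f ∈ SchwartzLattice n h) : Summable fun l => ‖f l‖ := by
  obtain ⟨C, -, hC⟩ := exists_norm_le hpos hf (-(2 * n : ℝ))
  exact (summable_weight.mul_left C).of_nonneg_of_le (fun _ => norm_nonneg _) hC

theorem amplitudeTerm_eq (a : HLattice n → HLattice n → Torus n → ℂ) (f : HLattice n → ℂ)
    (k l : HLattice n) : amplitudeTerm a f k l = mFourierCoeff (a k l) (l - k) * f l := by
  rw [amplitudeTerm, integral_mul_const, mFourierCoeff_eq_integral_latticeChar, neg_sub]

/-- The supremum bound on the coefficients suffices: it is polynomial in `l`, and `f` absorbs it. -/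
theorem summable_amplitudeTerm (hpos : 0 < h) (ha : a ∈ AmplitudeClass n h ρ δ μ₁ μ₂)
    {f : HLattice n → ℂ} (hf : f ∈ SchwartzLattice n h) (k : HLattice n) :
    Summable (amplitudeTerm a f k) := by
  obtain ⟨C, hC, Q, hQ, hb⟩ := amplitude_bound hpos ha 0 0 0
  simp only [multiDiff_zero, multiD_zero (ha.1 _ _)] at hb
  set s := μ₁ - ρ * (order (0 : Fin n → ℕ)) + δ * Q
  set t := μ₂ - ρ * (order (0 : Fin n → ℕ)) + δ * ((order (0 : Fin n → ℕ) : ℝ) - Q)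
  obtain ⟨D, hD, hd⟩ := SchwartzLattice.exists_norm_le hpos hf (-t + -(2 * n : ℝ))
  refine Summable.of_norm ((summable_weight.mul_left (C * weight k ^ s * D)).of_nonneg_of_le
    (fun _ => norm_nonneg _) fun l => ?_)
  rw [amplitudeTerm_eq, norm_mul]
  refine (mul_le_mul (norm_mFourierCoeff_le (hb k l) _) (hd l) (norm_nonneg _)
    (mul_nonneg hC (mul_pos (weight_rpow_pos k _) (weight_rpow_pos l _)).le)).trans_eq ?_
  have : weight l ^ t * weight l ^ (-t + -(2 * n : ℝ)) = weight l ^ (-(2 * n : ℝ)) := by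
    rw [← Real.rpow_add (weight_pos l)]
    congr 1
    ring
  rw [← this]
  ring

/-- Sum and integral are interchanged because `σ(k,·)` is bounded and `f` is summable. -/
theorem symbolOp_eq_tsum {σ : HLattice n → Torus n → ℂ} (hσ : ∀ k, IsSmoothOnTorus (σ k))
    {f : HLattice n → ℂ} (hf : Summable fun l => ‖f l‖) (k : HLattice n) :
    symbolOp σ f k = ∑' l, mFourierCoeff (σ k) (l - k) * f l := by
  obtain ⟨B, hB⟩ := (hσ k).exists_norm_le
  have hB0 : 0 ≤ B := (norm_nonneg _).trans (hB 0)
  have hsm : ∀ l, IsSmoothOnTorus fun θ => f l * (latticeChar (-(l - k)) θ * σ k θ) := fun l =>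
    ((isSmoothOnTorus_latticeChar _).mul (hσ k)).const_mul (f l)
  have hnorm : ∀ l (θ : Torus n), ‖f l * (latticeChar (-(l - k)) θ * σ k θ)‖ ≤ B * ‖f l‖ := by
    intro l θ
    rw [norm_mul, norm_mul, norm_latticeChar, one_mul, mul_comm]
    exact mul_le_mul_of_nonneg_right (hB θ) (norm_nonneg _)
  have hsumm : Summable fun l =>
      ∫ θ : Torus n, ‖f l * (latticeChar (-(l - k)) θ * σ k θ)‖ := by
    refine (hf.mul_left B).of_nonneg_of_le (fun l => integral_nonneg fun _ => norm_nonneg _)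
      fun l => ?_
    refine (integral_mono (hsm l).integrable.norm (integrable_const (B * ‖f l‖))
      (hnorm l)).trans_eq (by simp)
  have key := hasSum_integral_of_summable_integral_norm (fun l => (hsm l).integrable) hsumm
  have e : ∀ θ : Torus n, latticeChar k θ * σ k θ * latticeFourier f θ
      = ∑' l, f l * (latticeChar (-(l - k)) θ * σ k θ) := fun θ => by
    rw [latticeFourier, ← tsum_mul_left]
    refine tsum_congr fun l => ?_
    rw [neg_sub, sub_eq_add_neg, latticeChar_add]
    ring
  simp only [symbolOp, e]
  rw [← key.tsum_eq]
  refine tsum_congr fun l => ?_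
  rw [integral_const_mul, ← mFourierCoeff_eq_integral_latticeChar, mul_comm]

theorem amplitudeOp_eq_symbolOp (hpos : 0 < h) (hδ : 0 ≤ δ) (hδ1 : δ < 1)
    (ha : a ∈ AmplitudeClass n h ρ δ μ₁ μ₂) {f : HLattice n → ℂ}
    (hf : f ∈ SchwartzLattice n h) : amplitudeOp a f = symbolOp (amplitudeSymbol a) f := by
  ext k
  rw [symbolOp_eq_tsum (isSmoothOnTorus_amplitudeSymbol hpos hδ hδ1 ha)
    (SchwartzLattice.summable_norm hpos hf), amplitudeOp]
  refine tsum_congr fun l => ?_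
  rw [amplitudeTerm_eq, mFourierCoeff_amplitudeSymbol hpos hδ hδ1 ha, add_sub_cancel]

end SemiclassicalLattice

end

theorem mainTheorem2 (n : ℕ) (h : ℝ) (hpos : 0 < h) (hle : h ≤ 1)
    (ρ δ μ₁ μ₂ : ℝ) (hδ : 0 ≤ δ) (hδρ : δ < ρ) (hρ : ρ ≤ 1)
    (a : SemiclassicalLattice.HLattice n → SemiclassicalLattice.HLattice n →
      SemiclassicalLattice.Torus n → ℂ)
    (ha : a ∈ SemiclassicalLattice.AmplitudeClass n h ρ δ μ₁ μ₂) :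
    (∀ f ∈ SemiclassicalLattice.SchwartzLattice n h, ∀ k : SemiclassicalLattice.HLattice n,
      Summable (SemiclassicalLattice.amplitudeTerm a f k)) ∧
    ∃ σ ∈ SemiclassicalLattice.SymbolClass n h ρ δ (μ₁ + μ₂),
      (∀ f ∈ SemiclassicalLattice.SchwartzLattice n h,
        SemiclassicalLattice.amplitudeOp a f = SemiclassicalLattice.symbolOp σ f) ∧
      ∀ N : ℕ,
        (fun (k : SemiclassicalLattice.HLattice n) (θ : SemiclassicalLattice.Torus n) =>
          σ k θ - ∑ α ∈ SemiclassicalLattice.multiIndexLT n N,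
            SemiclassicalLattice.expansionTerm h a α k θ)
          ∈ SemiclassicalLattice.SymbolClass n h ρ δ (μ₁ + μ₂ - (N : ℝ) * (ρ - δ)) := by
  have hδ1 : δ < 1 := hδρ.trans_le hρ
  refine ⟨fun f hf k => SemiclassicalLattice.summable_amplitudeTerm hpos ha hf k,
    SemiclassicalLattice.amplitudeSymbol a, ?_,
    fun f hf => SemiclassicalLattice.amplitudeOp_eq_symbolOp hpos hδ hδ1 ha hf,
    SemiclassicalLattice.amplitudeSymbol_sub_mem_symbolClass hpos hδ hδ1 hδρ ha⟩
  -- At `N = 0` the subtracted sum is empty, so the expansion statement is membership of the symbol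
  -- itself.
  simpa [SemiclassicalLattice.multiIndexLT_zero] using
    SemiclassicalLattice.amplitudeSymbol_sub_mem_symbolClass hpos hδ hδ1 hδρ ha 0
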